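/- Proposition. Let $K_{1,3}$ be the claw and $K_3$ the triangle. All graphs are finite, simple and connected; a graph is cubic if every vertex has degree $3$. A $\{K_{1,3},K_3\}$-decomposition of a graph $G$ is a set of subgraphs of $G$, each isomorphic to $K_{1,3}$ or to $K_3$, such that every edge of $G$ belongs to exactly one of them. The following decision problem is in $\mathrm{P}$: given a cubic graph $G$, does $G$ admit a $\{K_{1,3},K_3\}$-decomposition? That is, the language over $\{0,1\}$ consisting of the encodings (number of vertices in unary, followed by a $0$ and the adjacency matrix) of the connected cubic graphs on $\{0,\dots,n-1\}$, $n\in\mathbb{N}$, that admit a $\{K_{1,3},K_3\}$-decomposition is decided by a deterministic Turing machine in a number of steps bounded by a polynomial in the length of the input. -/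

import Mathlib

/-- `D` is an `S`-decomposition of `G`: every member of `D` is a subgraph of `G` isomorphic to a
graph in `S`, and every edge of `G` lies in exactly one member of `D`. -/
structure IsDecomposition {V : Type} (S : Set (Σ W : Type, SimpleGraph W)) (G : SimpleGraph V)
    (D : Set G.Subgraph) : Prop where
  iso : ∀ H ∈ D, ∃ F ∈ S, Nonempty (H.coe ≃g F.2)
  cover : ∀ e ∈ G.edgeSet, ∃! H : G.Subgraph, H ∈ D ∧ e ∈ H.edgeSet

/-- `G` admits an `S`-decomposition. -/
def IsDecomposable {V : Type} (S : Set (Σ W : Type, SimpleGraph W)) (G : SimpleGraph V) : Prop :=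
  ∃ D : Set G.Subgraph, IsDecomposition S G D

/-- The claw `K_{1,3}`. -/
abbrev clawGraph : Σ W : Type, SimpleGraph W :=
  ⟨Fin 1 ⊕ Fin 3, completeBipartiteGraph (Fin 1) (Fin 3)⟩

/-- The triangle `K_3`. -/
abbrev triangleGraph : Σ W : Type, SimpleGraph W :=
  ⟨Fin 3, (⊤ : SimpleGraph (Fin 3))⟩

open Classical in
/-- A cubic graph: every vertex has degree three. -/
def IsCubic {n : ℕ} (G : SimpleGraph (Fin n)) : Prop :=
  G.IsRegularOfDegree 3

open Classical in
/-- The adjacency matrix of `G`, row by row, as a list of `n * n` bits. -/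
noncomputable def adjacencyBits {n : ℕ} (G : SimpleGraph (Fin n)) : List Bool :=
  (List.ofFn fun i : Fin n => List.ofFn fun j : Fin n => decide (G.Adj i j)).flatten

/-- The binary encoding of a graph on `Fin n`: the number `n` of vertices in unary, a terminating
zero, and then the `n * n` bits of the adjacency matrix. -/
noncomputable def encodeGraph {n : ℕ} (G : SimpleGraph (Fin n)) : List Bool :=
  List.replicate n true ++ false :: adjacencyBits G

/-- Distinct graphs have distinct encodings. -/
theorem encodeGraph_injective {n m : ℕ} (G : SimpleGraph (Fin n)) (H : SimpleGraph (Fin m))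
    (h : encodeGraph G = encodeGraph H) : ∃ e : n = m, e ▸ G = H := by
  have key : ∀ (n m : ℕ) (a b : List Bool),
     List.replicate n true ++ false :: a = List.replicate m true ++ false :: b → n = m ∧ a = b := by
    intro n
    induction n with
    | zero => intro m a b h; cases m <;> simp_all [List.replicate_succ]
    | succ n ih => 
      intro m a b h
      cases m with
      | zero => simp [List.replicate_succ] at h
      | succ m => 
        simp only [List.replicate_succ, List.cons_append, List.cons.injEq, true_and] at h
        have := ih m a b h
        exact ⟨by omega, this.2⟩
  obtain ⟨rfl, h2⟩ := key _ _ _ _ h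
  refine ⟨rfl, ?_⟩
  unfold adjacencyBits at h2
  have h3 := List.eq_iff_flatten_eq.2 ⟨h2, by simp [List.map_ofFn, Function.comp_def]⟩
  have h4 := List.ofFn_injective h3
  ext i j
  have h5 := List.ofFn_injective (congrFun h4 i)
  simpa using congrFun h5 j

/-- The `S`-decomposition problem on (connected) cubic graphs, as the language of the encodings of
its yes-instances. -/
def cubicDecompositionProblem (S : Set (Σ W : Type, SimpleGraph W)) : Set (List Bool) :=
  {w | ∃ (n : ℕ) (G : SimpleGraph (Fin n)),
    w = encodeGraph G ∧ G.Connected ∧ IsCubic G ∧ IsDecomposable S G}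

open Classical in
/-- The class P: the membership of an arbitrary bit string in `L` is decided by a Turing machine
(a deterministic machine with finitely many stacks) within a number of steps that is bounded by a
polynomial in the length of the string. -/
def InP (L : Set (List Bool)) : Prop :=
  Nonempty (Turing.TM2ComputableInPolyTime (fun w : List Bool => w) Computability.encodeBool
    (fun w : List Bool => decide (w ∈ L)))

/-!
A decomposition of a cubic graph into claws and triangles is determined by the set of centers of its
claws. As a claw uses all three edges at its center, this set is independent, and the edges between
the other vertices are partitioned by triangles. Unless the graph is the complete graph on four
vertices, these conditions can be checked locally (`SimpleGraph.isDecomposable_iff`):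

* of two adjacent vertices that are in no common triangle, exactly one is a center;
* of the two opposite vertices of a diamond, exactly one is a center;
* a vertex of a triangle that has no opposite in a diamond is not a center.

The first two conditions are of the form "the values at `u` and `v` differ", and the third one fixes
some values to `false`. Such a system is solved by propagation: the value of a vertex forces those
of the vertices that are related to it, and when nothing more is forced, any other vertex may be
given the value `false`, because complementing a solution outside the set of fixed vertices gives
another solution (`CubicDecomposition.Extends.run_roundFixed`). The values found satisfy all
constraints if any values do. The complete graph on four vertices has a decomposition, and the
constraints have a solution for it, so that no exception has to be made.

The remaining work is to carry this out on a Turing machine. Structured stack programs (`Prog`) are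
compiled to `Turing.FinTM2` with an exact count of the steps (`Prog.Exec.steps`). On top of them
there is a small language (`Fm`, `Cmd`) with binary relations on the vertices as its memory,
first-order formulas over these relations as its tests, and loops over all vertices. All its
programs run in polynomial time (`Cmd.within_prog`), so that every language that is defined by such
a command and a formula is in P (`Cmd.inP_language`), and the propagation can be written in it
(`CubicDecomposition.command`).
-/

/-! ### A structured language for stack machines -/

/-- Index variables of the high-level language. -/
abbrev Var := Fin 8

/-- Names of the binary relations held in memory. -/
abbrev RelSym := Fin 5

/-- The stacks of the machine. All of them hold bits. -/
inductive Stk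
  /-- the input -/
  | inp
  /-- the output -/
  | out
  /-- the number of vertices in unary -/
  | size
  /-- a buffer for the contents of `size` -/
  | sizeBuf
  /-- the part of a relation that has been moved out of the way -/
  | scratch
  /-- a buffer for the contents of an index variable -/
  | idxBuf
  /-- the value of an index variable in unary -/
  | idx (x : Var)
  /-- the number of iterations that are left in the loop over an index variable -/
  | todo (x : Var)
  /-- the matrix of a relation, row by row -/
  | rel (a : RelSym)
  deriving DecidableEq, Fintype

/-- The internal memory of the machine: a flag and the most recently popped symbol, if any. -/
abbrev Reg := Bool × Option Bool

/-- The contents of the stacks. -/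
abbrev Stacks := Stk → List Bool

/-- Structured programs. The only loop is `drain k p`, which pops the symbols of the stack `k` one
by one until it is empty and runs `p` after every symbol popped. -/
inductive Prog
  | push (k : Stk) (f : Reg → Bool)
  | pop (k : Stk)
  | load (f : Reg → Reg)
  | seq (p q : Prog)
  | ite (b : Reg → Bool) (p q : Prog)
  | drain (k : Stk) (p : Prog)

namespace Prog

/-- `Exec p c c' t`: the program `p` takes the memory `c` to `c'` in exactly `t` machine steps. -/
inductive Exec : Prog → Reg × Stacks → Reg × Stacks → ℕ → Prop
  | push {k f v S} : Exec (push k f) (v, S) (v, Function.update S k (f v :: S k)) 1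
  | pop {k v S} :
      Exec (pop k) (v, S) ((v.1, (S k).head?), Function.update S k (S k).tail) 1
  | load {f v S} : Exec (load f) (v, S) (f v, S) 1
  | seq {p q c₁ c₂ c₃ s t} : Exec p c₁ c₂ s → Exec q c₂ c₃ t → Exec (seq p q) c₁ c₃ (s + t)
  | ite_true {b p q v S c t} : b v = true → Exec p (v, S) c t → Exec (ite b p q) (v, S) c (1 + t)
  | ite_false {b p q v S c t} :
      b v = false → Exec q (v, S) c t → Exec (ite b p q) (v, S) c (1 + t)
  | drain_nil {k p v S} : S k = [] → Exec (drain k p) (v, S) ((v.1, none), S) 1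
  | drain_cons {k p v S a l c₁ c₂ s t} : S k = a :: l →
      Exec p ((v.1, some a), Function.update S k l) c₁ s → Exec (drain k p) c₁ c₂ t →
      Exec (drain k p) (v, S) c₂ (1 + (s + t))

/-- The control locations of a program. -/
def Label : Prog → Type
  | push _ _ | pop _ | load _ => Unit
  | seq p q => Label p ⊕ Label q
  | ite _ p q => Option (Label p ⊕ Label q)
  | drain _ p => Option (Label p)

instance Label.fintype : (p : Prog) → Fintype (Label p)
  | push _ _ | pop _ | load _ => inferInstanceAs (Fintype Unit)
  | seq p q =>
    letI := Label.fintype p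
    letI := Label.fintype q
    inferInstanceAs (Fintype (Label p ⊕ Label q))
  | ite _ p q =>
    letI := Label.fintype p
    letI := Label.fintype q
    inferInstanceAs (Fintype (Option (Label p ⊕ Label q)))
  | drain _ p =>
    letI := Label.fintype p
    inferInstanceAs (Fintype (Option (Label p)))

/-- The location at which a program starts. -/
def entry : (p : Prog) → Label p
  | push _ _ | pop _ | load _ => ()
  | seq p _ => Sum.inl (entry p)
  | ite _ _ _ => none
  | drain _ _ => none

/-- The machine code of a program whose locations are embedded by `emb` into those of a larger
machine, and which jumps to `exit` when it has finished. -/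
def code {Λ : Type} : (p : Prog) → (emb : Label p → Λ) → (exit : Λ) → Label p →
    Turing.TM2.Stmt (fun _ : Stk => Bool) Λ Reg
  | push k f, _, exit, _ => .push k f (.goto fun _ => exit)
  | pop k, _, exit, _ => .pop k (fun v a => (v.1, a)) (.goto fun _ => exit)
  | load f, _, exit, _ => .load f (.goto fun _ => exit)
  | seq p q, emb, exit, l =>
    match l with
    | .inl l => code p (emb ∘ Sum.inl) (emb (Sum.inr (entry q))) l
    | .inr l => code q (emb ∘ Sum.inr) exit l
  | ite b p q, emb, exit, l =>
    match l with
    | none => .branch b (.goto fun _ => emb (some (Sum.inl (entry p))))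
        (.goto fun _ => emb (some (Sum.inr (entry q))))
    | some (.inl l) => code p (emb ∘ some ∘ Sum.inl) exit l
    | some (.inr l) => code q (emb ∘ some ∘ Sum.inr) exit l
  | drain k p, emb, exit, l =>
    match l with
    | none => .pop k (fun v a => (v.1, a)) (.branch (fun v => v.2.isSome)
        (.goto fun _ => emb (some (entry p))) (.goto fun _ => exit))
    | some l => code p (emb ∘ some) (emb none) l

/-- `Steps M c c' t`: the machine `M` goes from `c` to `c'` in exactly `t` steps. -/
inductive Steps {Λ : Type} (M : Λ → Turing.TM2.Stmt (fun _ : Stk => Bool) Λ Reg) :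
    Turing.TM2.Cfg (fun _ : Stk => Bool) Λ Reg → Turing.TM2.Cfg (fun _ : Stk => Bool) Λ Reg →
    ℕ → Prop
  | refl {c} : Steps M c c 0
  | head {l v S c t} : Steps M (Turing.TM2.stepAux (M l) v S) c t →
      Steps M ⟨some l, v, S⟩ c (1 + t)

theorem Steps.trans {Λ : Type} {M : Λ → Turing.TM2.Stmt (fun _ : Stk => Bool) Λ Reg} {c₁ c₂ c₃}
    {s t : ℕ} (h : Steps M c₁ c₂ s) (h' : Steps M c₂ c₃ t) : Steps M c₁ c₃ (s + t) := by
  induction h with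
  | refl => simpa using h'
  | head _ ih => rw [add_assoc]; exact .head (ih h')

theorem Steps.single {Λ : Type} {M : Λ → Turing.TM2.Stmt (fun _ : Stk => Bool) Λ Reg} {l v S c}
    (h : Turing.TM2.stepAux (M l) v S = c) : Steps M ⟨some l, v, S⟩ c 1 := by
  subst h; exact .head .refl

/-- The machine code of a program executes the program, and takes the time that `Exec` says. -/
theorem Exec.steps {Λ : Type} {M : Λ → Turing.TM2.Stmt (fun _ : Stk => Bool) Λ Reg}
    {p : Prog} {c c' : Reg × Stacks} {t : ℕ} (h : Exec p c c' t) :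
    ∀ (emb : Label p → Λ) (exit : Λ), (∀ l, M (emb l) = code p emb exit l) →
      Steps M ⟨some (emb (entry p)), c.1, c.2⟩ ⟨some exit, c'.1, c'.2⟩ t := by
  induction h with
  | push => intro emb exit hM; exact .single (by rw [hM]; rfl)
  | pop => intro emb exit hM; exact .single (by rw [hM]; rfl)
  | load => intro emb exit hM; exact .single (by rw [hM]; rfl)
  | seq _ _ ih₁ ih₂ =>
    intro emb exit hM
    exact (ih₁ (emb ∘ Sum.inl) _ fun l => hM (Sum.inl l)).trans
      (ih₂ (emb ∘ Sum.inr) _ fun l => hM (Sum.inr l))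
  | ite_true hb _ ih =>
    intro emb exit hM
    refine (Steps.single ?_).trans (ih (emb ∘ some ∘ Sum.inl) _ fun l => hM (some (Sum.inl l)))
    rw [hM]; simp [entry, code, hb]; rfl
  | ite_false hb _ ih =>
    intro emb exit hM
    refine (Steps.single ?_).trans (ih (emb ∘ some ∘ Sum.inr) _ fun l => hM (some (Sum.inr l)))
    rw [hM]; simp [entry, code, hb]; rfl
  | @drain_nil k p v S hS =>
    intro emb exit hM
    refine Steps.single ?_
    have hu : Function.update S k [] = S := by rw [← hS]; exact Function.update_eq_self _ _
    rw [hM]; simp [entry, code, hS, hu]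
  | drain_cons hS _ _ ih₁ ih₂ =>
    intro emb exit hM
    refine (Steps.single ?_).trans
      ((ih₁ (emb ∘ some) _ fun l => hM (some l)).trans (ih₂ emb exit hM))
    rw [hM]; simp [entry, code, hS]; rfl

/-- The machine that executes a program and halts. -/
def machine (p : Prog) : Turing.FinTM2 where
  K := Stk
  k₀ := .inp
  k₁ := .out
  Γ _ := Bool
  Λ := Option (Label p)
  main := some (entry p)
  σ := Reg
  initialState := (false, none)
  m
    | none => .halt
    | some l => code p some none l

theorem Steps.iterate {Λ : Type} {M : Λ → Turing.TM2.Stmt (fun _ : Stk => Bool) Λ Reg} {c c'}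
    {t : ℕ} (h : Steps M c c' t) :
    (flip bind (Turing.TM2.step M))^[t] (some c) = some c' := by
  induction h with
  | refl => rfl
  | head _ ih => rw [add_comm, Function.iterate_succ_apply]; exact ih

/-- The initial memory on input `w`. -/
def start (w : List Bool) : Reg × Stacks :=
  ((false, none), fun k => if k = .inp then w else [])

/-- The final memory with output `b`. -/
def finish (b : Bool) : Reg × Stacks :=
  ((false, none), fun k => if k = .out then [b] else [])

open Classical in
/-- A language that is decided by a structured program in polynomial time is in P. -/
theorem inP_of_exec (L : Set (List Bool)) (p : Prog) (P : Polynomial ℕ)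
    (h : ∀ w, ∃ t ≤ P.eval w.length, Exec p (start w) (finish (decide (w ∈ L))) t) : InP L := by
  refine ⟨⟨⟨p.machine, Equiv.refl _, Equiv.refl _⟩, P + 1, fun w => ?_⟩⟩
  choose t ht hE using h w
  refine ⟨⟨t + 1, ?_⟩, by simpa using ht⟩
  have h1 := hE.steps (M := p.machine.m) (some : Label p → Option (Label p)) none fun _ => rfl
  have h2 := (h1.trans (Steps.single rfl)).iterate
  have e1 : Turing.initList p.machine (List.map (Equiv.refl Bool).invFun w) =
      ⟨some (some (entry p)), (start w).1, (start w).2⟩ := by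
    simp only [Turing.initList, start, machine]
    congr 1
    funext k
    by_cases hk : k = .inp
    · subst hk; simp; rfl
    · exact (dif_neg hk).trans (if_neg hk).symm
  have e2 : Turing.haltList p.machine (List.map (Equiv.refl Bool).invFun
      (Computability.encodeBool (decide (w ∈ L)))) =
      ⟨none, (finish (decide (w ∈ L))).1, (finish (decide (w ∈ L))).2⟩ := by
    simp only [Turing.haltList, finish, machine]
    congr 1
  simp only [Option.map_some]
  erw [e1, e2]; exact h2

end Prog

/-! ### Time-bounded execution of loops -/

namespace Prog

/-- `Within p c c' T`: the program `p` takes the memory `c` to `c'` in at most `T` machine steps. -/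
def Within (p : Prog) (c c' : Reg × Stacks) (T : ℕ) : Prop :=
  ∃ t ≤ T, Exec p c c' t

theorem Within.mono {p c c'} {T T' : ℕ} (h : Within p c c' T) (hT : T ≤ T') : Within p c c' T' :=
  let ⟨t, ht, h⟩ := h
  ⟨t, ht.trans hT, h⟩

theorem Within.congr {p v S v' S' v₁ S₁ v₁' S₁'} {T T₁ : ℕ} (h : Within p (v, S) (v', S') T)
    (hv : v₁ = v) (hS : S₁ = S) (hv' : v₁' = v') (hS' : S₁' = S') (hT : T ≤ T₁) :
    Within p (v₁, S₁) (v₁', S₁') T₁ := by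
  subst hv hS hv' hS'
  exact h.mono hT

theorem Within.seq {p q c₁ c₂ c₃} {T T' : ℕ} (h : Within p c₁ c₂ T) (h' : Within q c₂ c₃ T') :
    Within (seq p q) c₁ c₃ (T + T') :=
  let ⟨_, ht, h⟩ := h
  let ⟨_, ht', h'⟩ := h'
  ⟨_, add_le_add ht ht', h.seq h'⟩

theorem within_push (k f v S) :
    Within (push k f) (v, S) (v, Function.update S k (f v :: S k)) 1 :=
  ⟨1, le_rfl, .push⟩

theorem within_pop (k v S) :
    Within (pop k) (v, S) ((v.1, (S k).head?), Function.update S k (S k).tail) 1 :=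
  ⟨1, le_rfl, .pop⟩

theorem within_load (f v S) : Within (load f) (v, S) (f v, S) 1 :=
  ⟨1, le_rfl, .load⟩

/-- The program that does nothing. -/
def skip : Prog := load id

theorem within_skip (c) : Within skip c c 1 := within_load id c.1 c.2

theorem within_ite {b p q v S c T} (h₁ : b v = true → Within p (v, S) c T)
    (h₂ : b v = false → Within q (v, S) c T) : Within (ite b p q) (v, S) c (T + 1) := by
  cases hb : b v with
  | true =>
    obtain ⟨t, ht, h⟩ := h₁ hb
    exact ⟨1 + t, by omega, .ite_true hb h⟩
  | false =>
    obtain ⟨t, ht, h⟩ := h₂ hb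
    exact ⟨1 + t, by omega, .ite_false hb h⟩

/-- The rule for loops: `F i` and `f i` are the stacks and the flag after `i` iterations. -/
theorem within_drain {k p} {l : List Bool} {o : Option Bool} {T : ℕ} (f : ℕ → Bool)
    (F : ℕ → Stacks) (hF : ∀ i ≤ l.length, F i k = l.drop i)
    (h : ∀ i (hi : i < l.length), ∃ o', Within p
      ((f i, some l[i]), Function.update (F i) k (l.drop (i + 1))) ((f (i + 1), o'), F (i + 1)) T) :
    Within (drain k p) ((f 0, o), F 0) ((f l.length, none), F l.length)
      (l.length * (T + 1) + 1) := by
  induction l generalizing f F o with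
  | nil => exact ⟨1, by simp, .drain_nil (by simpa using hF 0 (by simp))⟩
  | cons a l ih =>
    obtain ⟨o', t, ht, hE⟩ := h 0 (by simp)
    obtain ⟨t', ht', hE'⟩ := ih (o := o') (fun i => f (i + 1)) (fun i => F (i + 1))
      (fun i hi => by simpa using hF (i + 1) (by simpa using hi))
      (fun i hi => h (i + 1) (by simpa using hi))
    refine ⟨1 + (t + t'), ?_, .drain_cons (by simpa using hF 0 (by simp)) (by simpa using hE) hE'⟩
    simp only [List.length_cons]
    linarith

/-- Move the contents of the stack `k` to the stack `k'`. -/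
def move (k k' : Stk) : Prog := drain k (push k' fun v => v.2.getD false)

theorem within_move {k k' : Stk} (hk : k ≠ k') (b o) (S : Stacks) :
    Within (move k k') ((b, o), S)
      ((b, none), Function.update (Function.update S k []) k' ((S k).reverse ++ S k'))
      ((S k).length * 2 + 1) := by
  have := within_drain (k := k) (p := push k' fun v => v.2.getD false) (l := S k) (o := o) (T := 1)
    (fun _ => b) (fun i => Function.update (Function.update S k ((S k).drop i)) k'
      (((S k).take i).reverse ++ S k'))
    (fun i _ => by simp [hk]) (fun i hi => ⟨some (S k)[i], by
      refine (within_push _ _ _ _).congr rfl rfl rfl ?_ le_rfl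
      funext z
      by_cases h1 : z = k'
      · subst h1
        have : (List.take (i + 1) (S k)).reverse = (S k)[i] :: (List.take i (S k)).reverse := by
          rw [List.take_succ_eq_append_getElem hi]
          simp only [List.reverse_append, List.reverse_singleton, List.singleton_append]
        simp [this, hk.symm]
      · by_cases h2 : z = k
        · subst h2; simp [h1]
        · simp [h1, h2]⟩)
  simpa [move] using this

theorem within_clear (k : Stk) (b o) (S : Stacks) :
    Within (drain k skip) ((b, o), S) ((b, none), Function.update S k [])
      ((S k).length * 2 + 1) := by
  have := within_drain (k := k) (p := skip) (l := S k) (o := o) (T := 1)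
    (fun _ => b) (fun i => Function.update S k ((S k).drop i))
    (fun i _ => by simp) (fun i hi => ⟨some (S k)[i], by simpa using within_skip _⟩)
  simpa using this

/-- Run `p` as many times as there are symbols on the stack `k`. The stack `k'` is used to
restore `k` in the end. -/
def times (k k' : Stk) (p : Prog) : Prog :=
  seq (drain k (seq (push k' fun _ => true) p)) (move k' k)

/-- The rule for counted loops: `G i` and `f i` are the stacks, except for the counter, and the
flag after `i` iterations. -/
theorem within_times {k k' : Stk} (hk : k ≠ k') {p : Prog} {m T : ℕ} (f : ℕ → Bool)
    (G : ℕ → Stacks) (o : Option Bool) (hG : ∀ i ≤ m, G i k = List.replicate m true)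
    (hG' : ∀ i ≤ m, G i k' = [])
    (h : ∀ i < m, ∀ o l l', ∃ o', Within p
      ((f i, o), Function.update (Function.update (G i) k l) k' l')
      ((f (i + 1), o'), Function.update (Function.update (G (i + 1)) k l) k' l') T) :
    Within (times k k' p) ((f 0, o), G 0) ((f m, none), G m) (m * (T + 4) + 2) := by
  have h1 := within_drain (k := k) (p := seq (push k' fun _ => true) p)
    (l := List.replicate m true) (o := o) (T := 1 + T) f
    (fun i => Function.update (Function.update (G i) k (List.replicate (m - i) true)) k'
      (List.replicate i true))
    (fun i _ => by simp [hk]) (fun i hi => by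
      obtain ⟨o', ho'⟩ := h i (by simpa using hi) (some true) (List.replicate (m - (i + 1)) true)
        (List.replicate (i + 1) true)
      refine ⟨o', ?_⟩
      refine Within.seq (within_push _ _ _ _) ?_
      refine ho'.congr (by simp) ?_ rfl rfl le_rfl
      funext z
      by_cases h1 : z = k'
      · subst h1; simp [hk.symm, List.replicate_succ]
      · by_cases h2 : z = k
        · subst h2; simp [h1]
        · simp [h1, h2])
  have h2 := within_move hk.symm (f m) none (Function.update (Function.update (G m) k []) k'
      (List.replicate m true))
  simp only [List.length_replicate, Nat.sub_self, List.replicate_zero] at h1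
  refine (h1.seq h2).congr rfl ?_ rfl ?_ ?_
  · funext z
    by_cases h1 : z = k'
    · subst h1; simp [hG']
    · by_cases h2 : z = k
      · subst h2; simp [hk, hG]
      · simp [h1, h2]
  · funext z
    by_cases h1 : z = k
    · subst h1; simp [hG, hk]
    · by_cases h2 : z = k'
      · subst h2; simp [hk, hk.symm, hG']
      · simp [h1, h2]
  · simp only [Function.update_self, List.length_replicate]
    linarith

end Prog

/-! ### A logical language of polynomial time programs -/

/-- A memory for graphs on `n` vertices: binary relations on the set of vertices. -/
abbrev Mem (n : ℕ) := RelSym → Fin n → Fin n → Bool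

/-- The matrix of a relation, row by row. -/
def matrixBits {n : ℕ} (R : Fin n → Fin n → Bool) : List Bool :=
  (List.ofFn fun i => List.ofFn fun j => R i j).flatten

/-- Add the pair `(u, v)` to the relation `a`. -/
def Mem.insert {n : ℕ} (A : Mem n) (a : RelSym) (u v : Fin n) : Mem n :=
  fun b i j => if b = a ∧ i = u ∧ j = v then true else A b i j

theorem matrixBits_eq_ofFn {n : ℕ} (R : Fin n → Fin n → Bool) :
    matrixBits R = List.ofFn fun k : Fin (n * n) => R k.divNat k.modNat := by
  rw [matrixBits, List.ofFn_mul]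
  congr 2
  funext i
  congr 1
  funext j
  have hn : 0 < n := i.pos
  congr 1
  · ext; simp [Fin.coe_divNat, Nat.mul_comm, Nat.add_div_of_dvd_right, hn, Nat.div_eq_of_lt j.2]
  · ext; simp [Fin.coe_modNat, Nat.mod_eq_of_lt j.2]

@[simp]
theorem length_matrixBits {n : ℕ} (R : Fin n → Fin n → Bool) : (matrixBits R).length = n * n := by
  simp [matrixBits_eq_ofFn]

theorem matrixIndex_lt {n : ℕ} (u v : Fin n) : (u : ℕ) * n + v < n * n := by
  have : (u : ℕ) + 1 ≤ n := u.2
  nlinarith [v.2]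

theorem getElem_matrixBits {n : ℕ} (R : Fin n → Fin n → Bool) (u v : Fin n) :
    (matrixBits R)[(u : ℕ) * n + v]'(by simpa using matrixIndex_lt u v) = R u v := by
  have hn : 0 < n := u.pos
  simp only [matrixBits_eq_ofFn, List.getElem_ofFn]
  congr 1
  · ext; simp [Fin.coe_divNat, Nat.mul_comm, Nat.add_div_of_dvd_right, hn, Nat.div_eq_of_lt v.2]
  · ext; simp [Fin.coe_modNat, Nat.mod_eq_of_lt v.2]

theorem matrixBits_insert {n : ℕ} (A : Mem n) (a : RelSym) (u v : Fin n) :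
    matrixBits (A.insert a u v a) = (matrixBits (A a)).set (u * n + v) true := by
  apply List.ext_getElem
  · simp
  intro k h1 h2
  simp only [length_matrixBits] at h1
  simp only [List.getElem_set, matrixBits_eq_ofFn, List.getElem_ofFn, Mem.insert, true_and]
  have hn : 0 < n := u.pos
  refine if_congr ?_ rfl rfl
  simp only [Fin.ext_iff, Fin.coe_divNat, Fin.coe_modNat]
  constructor
  · rintro ⟨h, h'⟩
    rw [← h, ← h', Nat.div_add_mod']
  · rintro rfl
    simp [Nat.mul_comm, Nat.add_div_of_dvd_right, hn, Nat.div_eq_of_lt v.2, Nat.mod_eq_of_lt v.2]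

theorem Mem.insert_of_ne {n : ℕ} (A : Mem n) {a b : RelSym} (u v : Fin n) (h : b ≠ a) :
    A.insert a u v b = A b := by
  funext i j
  simp [Mem.insert, h]

/-- First-order formulas with the binary relation symbols `RelSym`. -/
inductive Fm
  | tt
  | atom (a : RelSym) (x y : Var)
  | not (φ : Fm)
  | and (φ ψ : Fm)
  | ex (x : Var) (φ : Fm)

/-- Commands that change the memory: `add a x y φ` adds the pair `(x, y)` to the relation `a` if
the formula `φ` holds, and `loop x c` runs `c` for every vertex `x`, in order. -/
inductive Cmd
  | add (a : RelSym) (x y : Var) (φ : Fm)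
  | seq (c d : Cmd)
  | loop (x : Var) (c : Cmd)

/-- The truth of a formula. -/
def Fm.Holds {n : ℕ} (A : Mem n) : Fm → (Var → Fin n) → Prop
  | tt, _ => True
  | atom a x y, e => A a (e x) (e y) = true
  | not φ, e => ¬ φ.Holds A e
  | and φ ψ, e => φ.Holds A e ∧ ψ.Holds A e
  | ex x φ, e => ∃ i, φ.Holds A (Function.update e x i)

open Classical in
/-- The effect of a command on the memory. -/
noncomputable def Cmd.run {n : ℕ} : Cmd → (Var → Fin n) → Mem n → Mem n
  | add a x y φ, e, A => if φ.Holds A e then A.insert a (e x) (e y) else A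
  | seq c d, e, A => d.run e (c.run e A)
  | loop x c, e, A => (List.finRange n).foldl (fun A i => c.run (Function.update e x i) A) A

/-- No quantifier binds a variable of `U` or a variable that is bound already. -/
def Fm.Fresh : Fm → Finset Var → Prop
  | tt, _ => True
  | atom _ _ _, _ => True
  | not φ, U => φ.Fresh U
  | and φ ψ, U => φ.Fresh U ∧ ψ.Fresh U
  | ex x φ, U => x ∉ U ∧ φ.Fresh (insert x U)

/-- No loop or quantifier binds a variable of `U` or a variable that is bound already. -/
def Cmd.Fresh : Cmd → Finset Var → Prop
  | add _ _ _ φ, U => φ.Fresh U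
  | seq c d, U => c.Fresh U ∧ d.Fresh U
  | loop x c, U => x ∉ U ∧ c.Fresh (insert x U)

/-- The stacks that represent a memory, the values `e` of the index variables, and the numbers `r`
of iterations left in the loops. -/
def Mem.stacks {n : ℕ} (A : Mem n) (e r : Var → ℕ) : Stacks
  | .inp | .out | .sizeBuf | .scratch | .idxBuf => []
  | .size => List.replicate n true
  | .idx x => List.replicate (e x) true
  | .todo x => List.replicate (r x) true
  | .rel a => matrixBits (A a)

theorem Mem.stacks_update_idx {n : ℕ} (A : Mem n) (e r : Var → ℕ) (x : Var) (m : ℕ) :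
    A.stacks (Function.update e x m) r =
      Function.update (A.stacks e r) (.idx x) (List.replicate m true) := by
  funext z
  cases z <;> simp [Mem.stacks, Function.update_apply]
  split_ifs <;> rfl

theorem Mem.stacks_update_todo {n : ℕ} (A : Mem n) (e r : Var → ℕ) (x : Var) (m : ℕ) :
    A.stacks e (Function.update r x m) =
      Function.update (A.stacks e r) (.todo x) (List.replicate m true) := by
  funext z
  cases z <;> simp [Mem.stacks, Function.update_apply]
  split_ifs <;> rfl

namespace Prog

/-- The stacks when the first `j` bits `L` of the relation `a` have been moved to `scratch`. -/
def shifted (S : Stacks) (a : RelSym) (L : List Bool) (j : ℕ) : Stacks :=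
  Function.update (Function.update S (.rel a) (L.drop j)) .scratch (L.take j).reverse

theorem update_shifted (S : Stacks) (a : RelSym) (L : List Bool) (j : ℕ) {k : Stk} (l : List Bool)
    (h : k ≠ .rel a) (h' : k ≠ .scratch) :
    Function.update (shifted S a L j) k l = shifted (Function.update S k l) a L j := by
  rw [shifted, shifted, Function.update_comm h'.symm, Function.update_comm h.symm]

/-- Move one bit of the relation `a` to `scratch`. -/
def shift (a : RelSym) : Prog := seq (pop (.rel a)) (push .scratch fun v => v.2.getD false)

theorem within_shift (S : Stacks) (a : RelSym) (L : List Bool) {j : ℕ} (hj : j < L.length) (b o) :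
    ∃ o', Within (shift a) ((b, o), shifted S a L j) ((b, o'), shifted S a L (j + 1)) 2 := by
  refine ⟨some L[j], ((within_pop _ _ _).seq (within_push _ _ _ _)).congr rfl rfl ?_ ?_ le_rfl⟩
  · simp [shifted, hj]
  · have : (List.take (j + 1) L).reverse = L[j] :: (List.take j L).reverse := by
      rw [List.take_succ_eq_append_getElem hj]
      simp only [List.reverse_append, List.reverse_singleton, List.singleton_append]
    funext z
    by_cases h1 : z = .scratch
    · subst h1; simp [shifted, this, hj]
    · by_cases h2 : z = .rel a
      · subst h2; simp [shifted]
      · simp [shifted, h1, h2]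

/-- Move one row of the relation `a` to `scratch`. -/
def shiftRow (a : RelSym) : Prog := times .size .sizeBuf (shift a)

theorem within_shiftRow {S : Stacks} {n : ℕ} (hS : S .size = List.replicate n true)
    (hS' : S .sizeBuf = []) (a : RelSym) (L : List Bool) {j : ℕ} (hj : j + n ≤ L.length) (b o) :
    Within (shiftRow a) ((b, o), shifted S a L j) ((b, none), shifted S a L (j + n))
      (n * 6 + 2) :=
  within_times (by simp) (fun _ => b) (fun i => shifted S a L (j + i)) o
    (fun i _ => by simp [shifted, hS]) (fun i _ => by simp [shifted, hS'])
    fun i hi o l l' => by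
      simp only [update_shifted _ _ _ _ _ (show Stk.size ≠ .rel a by simp) (by simp),
        update_shifted _ _ _ _ _ (show Stk.sizeBuf ≠ .rel a by simp) (by simp)]
      exact within_shift _ a L (by omega) b o

/-- Move the bits of the relation `a` before the entry `(x, y)` to `scratch`. -/
def seek (a : RelSym) (x y : Var) : Prog :=
  seq (times (.idx x) .idxBuf (shiftRow a)) (times (.idx y) .idxBuf (shift a))

theorem within_seek {S : Stacks} {n : ℕ} (hS : S .size = List.replicate n true)
    (hS' : S .sizeBuf = []) (hB : S .idxBuf = []) (hs : S .scratch = [])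
    {x y : Var} {u v : Fin n} (hx : S (.idx x) = List.replicate u true)
    (hy : S (.idx y) = List.replicate v true) (a : RelSym) (ha : (S (.rel a)).length = n * n)
    (b o) :
    Within (seek a x y) ((b, o), S) ((b, none), shifted S a (S (.rel a)) (u * n + v))
      (n * (n * 6 + 12) + 4) := by
  have huv := matrixIndex_lt u v
  have h1 := within_times (k := .idx x) (k' := .idxBuf) (by simp) (p := shiftRow a)
    (m := u) (T := n * 6 + 2)
    (fun _ => b) (fun i => shifted S a (S (.rel a)) (i * n)) o
    (fun i _ => by simp [shifted, hx]) (fun i _ => by simp [shifted, hB])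
    fun i hi o l l' => by
      simp only [update_shifted _ _ _ _ _ (show Stk.idx x ≠ .rel a by simp) (by simp),
        update_shifted _ _ _ _ _ (show Stk.idxBuf ≠ .rel a by simp) (by simp)]
      refine ⟨none, ?_⟩
      rw [Nat.succ_mul]
      have : (i + 1) * n ≤ u * n := Nat.mul_le_mul_right _ hi
      exact within_shiftRow (by simp [hS]) (by simp [hS']) a _ (by nlinarith) b o
  have h2 := within_times (k := .idx y) (k' := .idxBuf) (by simp) (p := shift a) (m := v) (T := 2)
    (fun _ => b) (fun i => shifted S a (S (.rel a)) (u * n + i)) none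
    (fun i _ => by simp [shifted, hy]) (fun i _ => by simp [shifted, hB])
    fun i hi o l l' => by
      simp only [update_shifted _ _ _ _ _ (show Stk.idx y ≠ .rel a by simp) (by simp),
        update_shifted _ _ _ _ _ (show Stk.idxBuf ≠ .rel a by simp) (by simp)]
      exact within_shift _ a _ (by omega) b o
  refine (h1.seq h2).congr rfl ?_ rfl rfl ?_
  · have : Function.update S .scratch [] = S := by rw [← hs]; exact Function.update_eq_self _ _
    simp [shifted, this]
  · have := u.2.le
    have := v.2.le
    nlinarith

/-- Set the flag to the entry `(x, y)` of the relation `a`. -/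
def read (a : RelSym) (x y : Var) : Prog :=
  seq (seek a x y) (seq (pop (.rel a)) (seq (load fun v => (v.2.getD false, v.2))
    (seq (push (.rel a) fun v => v.2.getD false) (move .scratch (.rel a)))))

/-- Set the entry `(x, y)` of the relation `a` to true. -/
def write (a : RelSym) (x y : Var) : Prog :=
  seq (seek a x y) (seq (pop (.rel a))
    (seq (push (.rel a) fun _ => true) (move .scratch (.rel a))))

/-- Run `p` for every value of `x` less than `n`: the stack `todo x` counts down from `n` while
`idx x` counts up from zero, and `idx x` is cleared in the end. -/
def forLoop (x : Var) (p : Prog) : Prog :=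
  seq (times .size .sizeBuf (push (.todo x) fun _ => true))
    (seq (drain (.todo x) (seq p (push (.idx x) fun _ => true))) (drain (.idx x) skip))

section

variable {n : ℕ} (A : Mem n) (e : Var → Fin n) (r : Var → ℕ)

theorem within_read (a : RelSym) (x y : Var) (b o) :
    Within (read a x y) ((b, o), A.stacks (fun x => e x) r)
      ((A a (e x) (e y), none), A.stacks (fun x => e x) r) (n * (n * 8 + 12) + 8) := by
  have huv := matrixIndex_lt (e x) (e y)
  have huv' : (e x : ℕ) * n + e y < (matrixBits (A a)).length := by simpa using huv
  have h1 := within_seek (S := A.stacks (fun x => e x) r) (n := n) rfl rfl rfl rfl (x := x)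
    (y := y) (u := e x) (v := e y) rfl rfl a (by simp [Mem.stacks]) b o
  have h0 : (matrixBits (A a))[(e x : ℕ) * n + e y]? = some (A a (e x) (e y)) := by
    rw [List.getElem?_eq_getElem huv', getElem_matrixBits]
  refine (h1.seq ((within_pop _ _ _).seq ((within_load _ _ _).seq ((within_push _ _ _ _).seq
    (within_move (by simp) _ _ _))))).congr rfl rfl ?_ ?_ ?_
  · simp [shifted, Mem.stacks, h0]
  · funext z
    by_cases h : z = .rel a
    · subst h
      have : List.take ((e x : ℕ) * n + e y) (matrixBits (A a)) ++ A a (e x) (e y) ::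
          List.drop ((e x : ℕ) * n + e y + 1) (matrixBits (A a)) = matrixBits (A a) := by
        rw [← getElem_matrixBits (A a) (e x) (e y), List.getElem_cons_drop,
          List.take_append_drop]
      simp [shifted, Mem.stacks, h0, this]
    · by_cases h' : z = .scratch
      · subst h'; simp [Mem.stacks]
      · simp [shifted, h, h']
  · simp [shifted, Mem.stacks]
    have := min_le_left ((e x : ℕ) * n + e y) (n * n)
    nlinarith

theorem within_write (a : RelSym) (x y : Var) (b o) :
    Within (write a x y) ((b, o), A.stacks (fun x => e x) r)
      ((b, none), (A.insert a (e x) (e y)).stacks (fun x => e x) r) (n * (n * 8 + 12) + 8) := by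
  have huv := matrixIndex_lt (e x) (e y)
  have huv' : (e x : ℕ) * n + e y < (matrixBits (A a)).length := by simpa using huv
  have h1 := within_seek (S := A.stacks (fun x => e x) r) (n := n) rfl rfl rfl rfl (x := x)
    (y := y) (u := e x) (v := e y) rfl rfl a (by simp [Mem.stacks]) b o
  refine (h1.seq ((within_pop _ _ _).seq ((within_push _ _ _ _).seq
    (within_move (by simp) _ _ _)))).congr rfl rfl ?_ ?_ ?_
  · simp
  · funext z
    by_cases h : z = .rel a
    · subst h
      simp [shifted, Mem.stacks, matrixBits_insert, List.set_eq_take_append_cons_drop, huv]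
    · by_cases h' : z = .scratch
      · subst h'; simp [Mem.stacks]
      · have : (A.insert a (e x) (e y)).stacks (fun x => e x) r z =
            A.stacks (fun x => e x) r z := by
          cases z with
          | rel c => simp only [Mem.stacks]; rw [Mem.insert_of_ne]; simpa using h
          | _ => rfl
        simp [shifted, h, h', this]
  · simp [shifted, Mem.stacks]
    have := min_le_left ((e x : ℕ) * n + e y) (n * n)
    nlinarith

theorem within_forLoop {p : Prog} {x : Var} {T : ℕ} (f : ℕ → Bool) (B : ℕ → Mem n)
    (hx : (e x : ℕ) = 0) (hr : r x = 0)
    (h : ∀ (i : Fin n) o, ∃ o', Within p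
      ((f i, o), (B i).stacks (fun y => Function.update e x i y)
        (Function.update r x (n - (i + 1))))
      ((f (i + 1), o'), (B (i + 1)).stacks (fun y => Function.update e x i y)
        (Function.update r x (n - (i + 1)))) T) (o) :
    Within (forLoop x p) ((f 0, o), (B 0).stacks (fun x => e x) r)
      ((f n, none), (B n).stacks (fun x => e x) r) (n * (T + 9) + 4) := by
  have h1 := within_times (k := .size) (k' := .sizeBuf) (by simp)
    (p := push (.todo x) fun _ => true) (m := n) (T := 1) (fun _ => f 0)
    (fun i => (B 0).stacks (fun x => e x) (Function.update r x i)) o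
    (fun i _ => rfl) (fun i _ => rfl)
    fun i hi o l l' => ⟨o, (within_push _ _ _ _).congr rfl rfl rfl
      (by
        simp only [Mem.stacks_update_todo]
        funext z
        cases z <;> simp [Function.update_apply, List.replicate_succ]
        split_ifs <;> rfl) le_rfl⟩
  have h2 := within_drain (k := .todo x) (p := seq p (push (.idx x) fun _ => true))
    (l := List.replicate n true) (o := none) (T := T + 1) f
    (fun i => (B i).stacks (Function.update (fun x => e x) x i) (Function.update r x (n - i)))
    (fun i hi => by simp [Mem.stacks])
    (fun i hi => by
      have hi' : i < n := by simpa using hi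
      obtain ⟨o', ho'⟩ := h ⟨i, hi'⟩ (some true)
      have he : (fun y => ((Function.update e x ⟨i, hi'⟩ y : Fin n) : ℕ)) =
          Function.update (fun x => (e x : ℕ)) x i := by
        funext y
        by_cases hy : y = x
        · subst hy; simp
        · simp [hy]
      rw [he] at ho'
      refine ⟨o', (ho'.seq (within_push _ _ _ _)).congr (by simp) ?_ rfl ?_ le_rfl⟩
      · simp [Mem.stacks_update_todo]
      · simp only [Mem.stacks_update_todo, Mem.stacks_update_idx]
        funext z
        cases z <;> simp [Function.update_apply, List.replicate_succ]
        split_ifs <;> rfl)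
  have h3 := within_clear (.idx x) (f n) none
    ((B n).stacks (Function.update (fun x => (e x : ℕ)) x n) r)
  have hr' : Function.update r x 0 = r := by rw [← hr]; exact Function.update_eq_self _ _
  have he' : Function.update (fun x => (e x : ℕ)) x 0 = fun x => (e x : ℕ) := by
    rw [← hx]; exact Function.update_eq_self x (fun x => (e x : ℕ))
  simp only [List.length_replicate, Nat.sub_self, Nat.sub_zero, hr', he'] at h1 h2
  refine (h1.seq (h2.seq h3)).congr rfl rfl rfl ?_ ?_
  · have := Mem.stacks_update_idx (B n) (Function.update (fun x => (e x : ℕ)) x n) r x 0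
    simp only [Function.update_idem, he', List.replicate_zero] at this
    exact this
  · simp [Mem.stacks]
    nlinarith

end

end Prog

/-! ### Compilation of formulas and commands -/

/-- The program that sets the flag to the truth value of a formula. -/
def Fm.prog : Fm → Prog
  | tt => .load fun _ => (true, none)
  | atom a x y => .read a x y
  | not φ => .seq φ.prog (.load fun v => (!v.1, v.2))
  | and φ ψ => .seq φ.prog (.ite (fun v => v.1) ψ.prog .skip)
  | ex x φ => .seq (.load fun v => (false, v.2))
      (.forLoop x (.ite (fun v => v.1) .skip φ.prog))

/-- The program of a command. -/
def Cmd.prog : Cmd → Prog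
  | add a x y φ => .seq φ.prog (.seq (.ite (fun v => v.1) (.write a x y) .skip)
      (.load fun _ => (false, none)))
  | seq c d => .seq c.prog d.prog
  | loop x c => .forLoop x c.prog

open Polynomial in
/-- The program of a formula is correct and runs in polynomial time. The variables that occur bound
in `φ` have to start with empty stacks, as the loops of the program count from there; freshness
makes sure that nested loops do not share these stacks. -/
theorem Fm.within_prog {φ : Fm} {U : Finset Var} (hφ : φ.Fresh U) :
    ∃ P : ℕ[X], ∀ (n : ℕ) (A : Mem n) (e : Var → Fin n) (r : Var → ℕ),
      (∀ y ∉ U, (e y : ℕ) = 0 ∧ r y = 0) → ∀ b o q, (q = true ↔ φ.Holds A e) → φ.prog.Within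
        ((b, o), A.stacks (fun x => e x) r) ((q, none), A.stacks (fun x => e x) r) (P.eval n) := by
  classical
  induction φ generalizing U with
  | tt =>
    refine ⟨1, fun n A e r _ b o q hq => ?_⟩
    obtain rfl : q = true := hq.2 trivial
    simpa [prog] using Prog.within_load (fun _ => (true, none)) (b, o) _
  | atom a x y =>
    refine ⟨X * (X * 8 + 12) + 8, fun n A e r _ b o q hq => ?_⟩
    obtain rfl : q = A a (e x) (e y) := Bool.eq_iff_iff.2 hq
    simpa [prog] using Prog.within_read A e r a x y b o
  | not φ ih =>
    obtain ⟨P, hP⟩ := ih hφ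
    refine ⟨P + 1, fun n A e r hU b o q hq => ?_⟩
    have h := hP n A e r hU b o (!q) (by rw [← not_iff_not, ← Holds, ← hq]; simp)
    exact (h.seq (Prog.within_load _ _ _)).congr rfl rfl (by simp) rfl (by simp)
  | and φ ψ ihφ ihψ =>
    obtain ⟨P, hP⟩ := ihφ hφ.1
    obtain ⟨Q, hQ⟩ := ihψ hφ.2
    refine ⟨P + (Q + 1 + 1), fun n A e r hU b o q hq => ?_⟩
    simp only [eval_add, eval_one]
    refine (hP n A e r hU b o (decide (φ.Holds A e)) decide_eq_true_iff).seq
      (Prog.within_ite (fun h => ?_) (fun h => ?_))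
    · have h : φ.Holds A e := by simpa using h
      exact (hQ n A e r hU _ _ q (hq.trans (and_iff_right h))).mono (Nat.le_succ _)
    · have h : ¬ φ.Holds A e := by simpa using h
      obtain rfl : q = false := by
        rw [← Bool.not_eq_true, hq]; exact fun h' => h h'.1
      exact (Prog.within_skip _).congr rfl rfl (by simp [h]) rfl (by simp)
  | ex x φ ih =>
    obtain ⟨P, hP⟩ := ih hφ.2
    refine ⟨1 + (X * (P + 1 + 1 + 9) + 4), fun n A e r hU b o q hq => ?_⟩
    -- `E i`: the formula holds for one of the first `i` vertices
    obtain ⟨E, hE0, hEn, hsucc⟩ : ∃ E : ℕ → Prop, ¬ E 0 ∧ (E n ↔ q = true) ∧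
        ∀ i : Fin n, E (i + 1) ↔ E i ∨ φ.Holds A (Function.update e x i) := by
      refine ⟨fun i => ∃ j : Fin n, (j : ℕ) < i ∧ φ.Holds A (Function.update e x j), by simp,
        by simp [hq, Holds], fun i => ?_⟩
      have hlt : ∀ j : Fin n, (j : ℕ) < i + 1 ↔ (j : ℕ) < i ∨ j = i := fun j => by
        rw [Fin.ext_iff]; omega
      simp only [hlt, or_and_right, exists_or, exists_eq_left]
    have h1 := Prog.within_forLoop e r (p := .ite (fun v => v.1) .skip φ.prog) (x := x)
      (T := P.eval n + 1 + 1) (fun i => decide (E i)) (fun _ => A) (hU x hφ.1).1 (hU x hφ.1).2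
      (fun i o => ?_) o
    · simp only [hE0, hEn, decide_false, Bool.decide_eq_true] at h1
      exact ((Prog.within_load _ _ _).seq h1).congr rfl rfl rfl rfl (by simp)
    · by_cases h : E i
      · refine ⟨o, Prog.within_ite (fun _ => ?_) (fun h' => ?_)⟩
        · exact (Prog.within_skip _).congr rfl rfl (by simp [hsucc, h]) rfl (by simp)
        · simp [h] at h'
      · refine ⟨none, Prog.within_ite (fun h' => ?_) (fun _ => ?_)⟩
        · simp [h] at h'
        · refine (hP n A _ _ (fun y hy => ?_) _ _ _ (by simp [hsucc, h])).mono (Nat.le_succ _)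
          simp only [Finset.mem_insert, not_or] at hy
          simpa [hy.1] using hU y hy.2

open Polynomial in
/-- The program of a command is correct and runs in polynomial time. -/
theorem Cmd.within_prog {c : Cmd} {U : Finset Var} (hc : c.Fresh U) :
    ∃ P : ℕ[X], ∀ (n : ℕ) (A : Mem n) (e : Var → Fin n) (r : Var → ℕ),
      (∀ y ∉ U, (e y : ℕ) = 0 ∧ r y = 0) → ∀ o, ∃ o', c.prog.Within
        ((false, o), A.stacks (fun x => e x) r)
        ((false, o'), (c.run e A).stacks (fun x => e x) r) (P.eval n) := by
  classical
  induction c generalizing U with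
  | add a x y φ =>
    obtain ⟨P, hP⟩ := Fm.within_prog hc
    refine ⟨P + (X * (X * 8 + 12) + 8 + 1 + 1), fun n A e r hU o => ⟨none, ?_⟩⟩
    simp only [eval_add, eval_one, eval_mul, eval_X, eval_ofNat]
    have h := Prog.within_ite (b := fun v => v.1) (p := .write a x y) (q := .skip)
      (v := (decide (φ.Holds A e), none)) (S := A.stacks (fun x => e x) r)
      (c := ((decide (φ.Holds A e), none), ((Cmd.add a x y φ).run e A).stacks (fun x => e x) r))
      (T := n * (n * 8 + 12) + 8)
      (fun h => by
        have h : φ.Holds A e := by simpa using h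
        simpa [h, Cmd.run] using Prog.within_write A e r a x y true none)
      (fun h => by
        have h : ¬ φ.Holds A e := by simpa using h
        simpa [h, Cmd.run] using (Prog.within_skip _).mono (by simp))
    exact (hP n A e r hU false o _ decide_eq_true_iff).seq (h.seq (Prog.within_load _ _ _))
  | seq c d ihc ihd =>
    obtain ⟨P, hP⟩ := ihc hc.1
    obtain ⟨Q, hQ⟩ := ihd hc.2
    refine ⟨P + Q, fun n A e r hU o => ?_⟩
    obtain ⟨o', h⟩ := hP n A e r hU o
    obtain ⟨o'', h'⟩ := hQ n (c.run e A) e r hU o'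
    exact ⟨o'', (h.seq h').mono (by simp)⟩
  | loop x c ih =>
    obtain ⟨P, hP⟩ := ih hc.2
    refine ⟨X * (P + 9) + 4, fun n A e r hU o => ⟨none, ?_⟩⟩
    have h1 := Prog.within_forLoop e r (p := c.prog) (x := x)
      (T := P.eval n) (fun _ => false)
      (fun i => ((List.finRange n).take i).foldl (fun A i => c.run (Function.update e x i) A) A)
      (hU x hc.1).1 (hU x hc.1).2 (fun i o => ?_) o
    · have hn : (List.finRange n).take n = List.finRange n := List.take_of_length_le (by simp)
      exact h1.congr rfl rfl rfl (by simp only [run, hn]) (by simp)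
    · obtain ⟨o', h⟩ := hP n (((List.finRange n).take i).foldl
        (fun A i => c.run (Function.update e x i) A) A) (Function.update e x i)
        (Function.update r x (n - (i + 1))) (fun y hy => by
          simp only [Finset.mem_insert, not_or] at hy
          simpa [hy.1] using hU y hy.2) o
      refine ⟨o', h.congr rfl rfl rfl ?_ le_rfl⟩
      rw [List.take_succ_eq_append_getElem (by simp), List.foldl_append]
      simp

/-! ### Decision by a command and a formula -/

theorem matrixBits_surjective {n : ℕ} {l : List Bool} (hl : l.length = n * n) :
    ∃ R : Fin n → Fin n → Bool, matrixBits R = l := by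
  refine ⟨fun u v => l[(u : ℕ) * n + v]'(hl ▸ matrixIndex_lt u v), ?_⟩
  rw [matrixBits_eq_ofFn]
  refine List.ext_getElem (by simp [hl]) fun k h1 h2 => ?_
  simp [Fin.coe_divNat, Fin.coe_modNat, Nat.div_add_mod']

theorem matrixBits_injective {n : ℕ} :
    Function.Injective (matrixBits : (Fin n → Fin n → Bool) → List Bool) := by
  intro R R' h
  funext u v
  rw [← getElem_matrixBits R u v, ← getElem_matrixBits R' u v]
  simp only [h]

theorem unary_append_inj {n m : ℕ} {a b : List Bool}
    (h : List.replicate n true ++ false :: a = List.replicate m true ++ false :: b) :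
    n = m ∧ a = b := by
  induction n generalizing m with
  | zero => cases m <;> simp_all [List.replicate_succ]
  | succ n ih =>
    cases m with
    | zero => simp [List.replicate_succ] at h
    | succ m =>
      simp only [List.replicate_succ, List.cons_append, List.cons.injEq, true_and] at h
      have := ih h
      exact ⟨by omega, this.2⟩

/-- The memory in which the relation `0` is `R` and all other relations are empty. -/
def Mem.initial {n : ℕ} (R : Fin n → Fin n → Bool) : Mem n :=
  fun a => if a = 0 then R else fun _ _ => false

namespace Prog

theorem Within.drain_cons {k p v S a l c₁ c₂} {T T' : ℕ} (hS : S k = a :: l)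
    (h : Within p ((v.1, some a), Function.update S k l) c₁ T)
    (h' : Within (drain k p) c₁ c₂ T') : Within (drain k p) (v, S) c₂ (1 + (T + T')) :=
  let ⟨_, ht, h⟩ := h
  let ⟨_, ht', h'⟩ := h'
  ⟨_, by omega, .drain_cons hS h h'⟩

/-- A step pushes at most one symbol, so that a time bound is a bound for the stacks as well. -/
theorem Exec.length_le {p c c'} {t : ℕ} (h : Exec p c c' t) (k : Stk) :
    (c'.2 k).length ≤ (c.2 k).length + t := by
  induction h with
  | @push k' f v S =>
    by_cases hk : k = k'
    · subst hk; simp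
    · simp [hk]
  | @pop k' v S =>
    by_cases hk : k = k'
    · subst hk; simp; omega
    · simp [hk]
  | load => simp
  | seq _ _ ih ih' => omega
  | ite_true _ _ ih => omega
  | ite_false _ _ ih => omega
  | drain_nil => simp
  | @drain_cons k' p v S a l c₁ c₂ s t hS _ _ ih ih' =>
    have : (Function.update S k' l k).length ≤ (S k).length := by
      by_cases hk : k = k'
      · subst hk; simp [hS]
      · simp [hk]
    simp only at ih ⊢
    omega

/-- Split the input at the first zero: the ones before it go to `size`, the bits after it go in
reverse order to `scratch`. The flag is set if there is a zero. -/
def parse : Prog :=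
  drain .inp (ite (fun v => v.1) (push .scratch fun v => v.2.getD false)
    (ite (fun v => v.2.getD false) (push .size fun _ => true) (load fun v => (true, v.2))))

theorem within_parse_true (l : List Bool) (S : Stacks) (o) (hS : S .inp = l) :
    Within parse ((true, o), S) ((true, none), Function.update (Function.update S .inp []) .scratch
      (l.reverse ++ S .scratch)) (4 * l.length + 1) := by
  induction l generalizing S o with
  | nil =>
    refine ⟨1, by simp, ?_⟩
    have : Function.update S .inp [] = S := by rw [← hS]; exact Function.update_eq_self _ _
    simpa [this, parse] using Exec.drain_nil (v := (true, o)) hS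
  | cons a l ih =>
    have h1 := within_ite (b := fun v => v.1) (p := push .scratch fun v => v.2.getD false)
      (q := ite (fun v => v.2.getD false) (push .size fun _ => true) (load fun v => (true, v.2)))
      (v := (true, some a)) (S := Function.update S .inp l)
      (fun _ => within_push _ _ _ _) (fun h => by simp at h)
    refine (Within.drain_cons hS h1 (ih _ _ (by simp))).congr rfl rfl rfl ?_ ?_
    · funext z
      cases z <;> simp
    · simp only [List.length_cons]; omega

/-- If the input has a zero, the flag `q` is set and `bits` is what follows the first zero. -/
theorem within_parse (l : List Bool) (S : Stacks) (o) (hS : S .inp = l) :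
    ∃ q n bits, l = List.replicate n true ++ (if q then false :: bits else []) ∧
      Within parse ((false, o), S) ((q, none), Function.update (Function.update (Function.update S
        .inp []) .size (List.replicate n true ++ S .size)) .scratch (bits.reverse ++ S .scratch))
        (4 * l.length + 1) := by
  induction l generalizing S o with
  | nil =>
    refine ⟨false, 0, [], by simp, 1, by simp, ?_⟩
    have : Function.update S .inp [] = S := by rw [← hS]; exact Function.update_eq_self _ _
    simpa [this, parse] using Exec.drain_nil (v := (false, o)) hS
  | cons a l ih =>
    cases a with
    | true =>
      obtain ⟨q, n, bits, hl, h⟩ := ih (Function.update (Function.update S .inp l) .size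
        (true :: S .size)) (some true) (by simp)
      refine ⟨q, n + 1, bits, by rw [hl]; simp [List.replicate_succ], ?_⟩
      have h1 := within_ite (b := fun v => v.1) (p := push .scratch fun v => v.2.getD false)
        (q := ite (fun v => v.2.getD false) (push .size fun _ => true)
          (load fun v => (true, v.2)))
        (v := (false, some true)) (S := Function.update S .inp l)
        (fun h => by simp at h) (fun _ => within_ite (fun _ => within_push _ _ _ _)
          (fun h => by simp at h))
      refine (Within.drain_cons hS h1 h).congr rfl rfl rfl ?_ ?_
      · funext z
        cases z <;> simp [List.replicate_succ']
      · simp only [List.length_cons]; omega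
    | false =>
      refine ⟨true, 0, l, by simp, ?_⟩
      have h1 := within_ite (b := fun v => v.1) (p := push .scratch fun v => v.2.getD false)
        (q := ite (fun v => v.2.getD false) (push .size fun _ => true)
          (load fun v => (true, v.2)))
        (v := (false, some false)) (S := Function.update S .inp l)
        (fun h => by simp at h) (fun _ => within_ite (fun h => by simp at h)
          (fun _ => within_load _ _ _))
      refine (Within.drain_cons hS h1 (within_parse_true l _ _ (by simp))).congr rfl rfl rfl ?_ ?_
      · funext z
        cases z <;> simp
      · simp only [List.length_cons]; omega

/-- Move one bit from `scratch` to the relation `0` and push a zero to all other relations. The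
flag is cleared if there is no such bit. -/
def fillCell : Prog :=
  seq (pop .scratch) (seq (load fun v => (v.1 && v.2.isSome, v.2))
    (seq (push (.rel 0) fun v => v.2.getD false) (seq (push (.rel 1) fun _ => false)
      (seq (push (.rel 2) fun _ => false) (seq (push (.rel 3) fun _ => false)
        (push (.rel 4) fun _ => false))))))

/-- The stacks after `j` bits `L` from `scratch` have been moved. -/
def filled (S : Stacks) (L : List Bool) (j : ℕ) : Stacks
  | .scratch => L.drop j
  | .rel a => if a = 0 then ((List.range j).map fun i => L.getD i false).reverse
      else List.replicate j false
  | k => S k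

theorem update_filled (S : Stacks) (L : List Bool) (j : ℕ) {k : Stk} (l : List Bool)
    (h : ∀ a, k ≠ .rel a) (h' : k ≠ .scratch) :
    Function.update (filled S L j) k l = filled (Function.update S k l) L j := by
  funext z
  by_cases hz : z = k
  · subst hz
    cases z <;> simp_all [filled]
  · cases z <;> simp [filled, hz]

theorem within_fillCell (S : Stacks) (L : List Bool) (j : ℕ) (b o) :
    ∃ o', Within fillCell ((b && decide (j ≤ L.length), o), filled S L j)
      ((b && decide (j + 1 ≤ L.length), o'), filled S L (j + 1)) 7 := by
  refine ⟨L[j]?, ((within_pop _ _ _).seq ((within_load _ _ _).seq ((within_push _ _ _ _).seq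
    ((within_push _ _ _ _).seq ((within_push _ _ _ _).seq ((within_push _ _ _ _).seq
    (within_push _ _ _ _))))))).congr rfl rfl ?_ ?_ le_rfl⟩
  · have : (j ≤ L.length ∧ j < L.length) ↔ j + 1 ≤ L.length := by omega
    have h : L[j]?.isSome = decide (j < L.length) := by rw [Bool.eq_iff_iff]; simp
    simp [filled, ← this, Bool.and_assoc, h]
  · funext z
    cases z with
    | rel a =>
      fin_cases a <;>
        simp [filled, List.range_succ, List.replicate_succ,
          List.getD_eq_getElem?_getD]
    | _ => simp [filled]

/-- Move `n * n` bits from `scratch` to the relation `0`, where `n` is the number on `size`. The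
flag remains set if there are exactly that many bits and `n` is positive. -/
def fill : Prog :=
  seq (times .size .sizeBuf (push (.todo 0) fun _ => true))
    (seq (drain (.todo 0) (times .size .sizeBuf fillCell))
      (seq (pop .scratch) (seq (load fun v => (v.1 && v.2.isNone, v.2))
        (seq (pop .size) (seq (load fun v => (v.1 && v.2.isSome, v.2))
          (push .size fun _ => true))))))

/-- Inputs of the wrong length and graphs without vertices are rejected by the flag; the stacks
matter only for the other inputs. -/
theorem within_fill {S : Stacks} {n : ℕ} (b o) (hS : S .size = List.replicate n true)
    (hB : S .sizeBuf = []) (ht : S (.todo 0) = []) (hrel : ∀ a, S (.rel a) = []) :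
    ∃ o' S', Within fill ((b, o), S)
      ((b && decide ((S .scratch).length = n * n) && decide (0 < n), o'), S')
      (n * (n * 11 + 9) + 8) ∧
      ((S .scratch).length = n * n → 0 < n → S' = filled S (S .scratch) (n * n)) := by
  set L := S .scratch with hL
  have hfill (l) : filled (Function.update S (.todo 0) l) L 0 = Function.update S (.todo 0) l := by
    funext z
    cases z <;> simp [filled, hL, hrel]
  have h1 := within_times (k := .size) (k' := .sizeBuf) (by simp)
    (p := push (.todo 0) fun _ => true) (m := n) (T := 1) (fun _ => b)
    (fun i => Function.update S (.todo 0) (List.replicate i true)) o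
    (fun i _ => by simp [hS]) (fun i _ => by simp [hB])
    fun i hi o l l' => ⟨o, (within_push _ _ _ _).congr rfl rfl rfl
      (by
        funext z
        by_cases h : z = .todo 0
        · subst h; simp [List.replicate_succ]
        · simp [Function.update_apply, h]) le_rfl⟩
  have h2 := within_drain (k := .todo 0) (p := times .size .sizeBuf fillCell)
    (l := List.replicate n true) (o := none) (T := n * 11 + 2)
    (fun i => b && decide (i * n ≤ L.length))
    (fun i => filled (Function.update S (.todo 0) (List.replicate (n - i) true)) L (i * n))
    (fun i hi => by simp [filled])
    (fun i hi => by
      refine ⟨none, (within_times (k := .size) (k' := .sizeBuf) (by simp) (p := fillCell)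
        (m := n) (T := 7) (fun j => b && decide (i * n + j ≤ L.length))
        (fun j => filled (Function.update S (.todo 0) (List.replicate (n - (i + 1)) true)) L
          (i * n + j)) (some true) (fun j _ => by simp [filled, hS])
          (fun j _ => by simp [filled, hB]) fun j hj o l l' => ?_).congr (by simp) ?_ ?_ ?_ le_rfl⟩
      · simp only [update_filled _ _ _ _ (show ∀ a, Stk.size ≠ .rel a by simp) (by simp),
          update_filled _ _ _ _ (show ∀ a, Stk.sizeBuf ≠ .rel a by simp) (by simp)]
        exact within_fillCell _ L _ b o
      · rw [update_filled _ _ _ _ (by simp) (by simp)]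
        simp
      · simp [Nat.succ_mul]
      · simp [Nat.succ_mul])
  have hupd : Function.update S (.todo 0) [] = S := by
    rw [← ht]; exact Function.update_eq_self _ _
  simp only [List.length_replicate, Nat.sub_self, List.replicate_zero, Nat.sub_zero, zero_mul,
    Nat.zero_le, decide_true, Bool.and_true, hfill, hupd] at h1 h2
  refine ⟨(List.replicate n true).head?, _, (h1.seq (h2.seq ((within_pop _ _ _).seq
    ((within_load _ _ _).seq ((within_pop _ _ _).seq ((within_load _ _ _).seq
    (within_push _ _ _ _))))))).congr rfl rfl ?_ rfl ?_, ?_⟩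
  · have h3 : L[n * n]?.isNone = decide (L.length ≤ n * n) := by rw [Bool.eq_iff_iff]; simp
    have h4 : (List.replicate n true).head?.isSome = decide (0 < n) := by
      cases n <;> simp [List.replicate_succ]
    have h5 : decide (L.length = n * n) = (decide (n * n ≤ L.length) && decide (L.length ≤ n * n))
        := by rw [Bool.eq_iff_iff]; simp; omega
    simp [filled, h3, h4, h5, hS, Bool.and_assoc]
  · nlinarith
  · intro h hn
    obtain ⟨m, rfl⟩ := Nat.exists_eq_add_of_lt hn
    funext z
    cases z <;> simp [filled, hS, h, List.replicate_succ]

/-- Clear the stacks of a list. -/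
def clear : List Stk → Prog
  | [] => skip
  | k :: ks => seq (drain k skip) (clear ks)

theorem within_clear_list (ks : List Stk) (S : Stacks) (b o) (M : ℕ)
    (hM : ∀ k, (S k).length ≤ M) : ∃ o', Within (clear ks) ((b, o), S)
      ((b, o'), fun k => if k ∈ ks then [] else S k) (ks.length * (M * 2 + 1) + 1) := by
  induction ks generalizing S o with
  | nil => exact ⟨o, by simpa [clear] using within_skip _⟩
  | cons k ks ih =>
    obtain ⟨o', h⟩ := ih (Function.update S k []) none fun k' => by
      by_cases hk : k' = k
      · subst hk; simp
      · simpa [hk] using hM k'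
    refine ⟨o', ((within_clear k b o S).seq h).congr rfl rfl rfl ?_ ?_⟩
    · funext k'
      by_cases hk : k' = k
      · subst hk; simp
      · simp [hk]
    · have := hM k
      simp only [List.length_cons]
      nlinarith

/-- Parse the input, run a command and evaluate a formula. -/
def evaluate (c : Cmd) (φ : Fm) : Prog :=
  seq parse (seq (ite (fun v => v.1) fill skip)
    (ite (fun v => v.1) (seq (load fun _ => (false, none)) (seq c.prog φ.prog)) skip))

/-- Parse the input, run a command, evaluate a formula, clear the stacks and output the flag. -/
noncomputable def decider (c : Cmd) (φ : Fm) : Prog :=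
  seq (evaluate c φ) (seq (clear Finset.univ.toList)
    (seq (push .out fun v => v.1) (load fun _ => (false, none))))

end Prog

theorem Polynomial.eval_mono_nat (P : Polynomial ℕ) {m n : ℕ} (h : m ≤ n) :
    P.eval m ≤ P.eval n := by
  simp only [Polynomial.eval_eq_sum_range]
  gcongr

/-- The language of the matrices `R` such that the formula `φ` holds after the command `c` has been
run on the memory that consists of `R`. -/
def Cmd.language (c : Cmd) (φ : Fm) : Set (List Bool) :=
  {w | ∃ (n : ℕ) (h : 0 < n) (R : Fin n → Fin n → Bool),
    w = List.replicate n true ++ false :: matrixBits R ∧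
    φ.Holds (c.run (fun _ => ⟨0, h⟩) (Mem.initial R)) fun _ => ⟨0, h⟩}

/-- After a successful parse the stacks are those of the initial memory. The two reversals of the
matrix, on the way to `scratch` and back, cancel. -/
theorem Prog.filled_eq_stacks {n : ℕ} (R : Fin n → Fin n → Bool) {S : Stacks} {L : List Bool}
    (hS : ∀ k ≠ .scratch, S k = if k = .size then List.replicate n true else [])
    (hR : matrixBits R = L.reverse) :
    filled S L (n * n) = (Mem.initial R).stacks (fun _ => 0) (fun _ => 0) := by
  have hL : L.length = n * n := by rw [← List.length_reverse, ← hR, length_matrixBits]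
  funext z
  cases z with
  | rel a =>
    simp only [filled, Mem.stacks, Mem.initial]
    split_ifs with ha
    · rw [hR]
      congr 1
      refine List.ext_getElem (by simp [hL]) fun k h1 h2 => ?_
      simp [h2]
    · rw [matrixBits_eq_ofFn]
      simp
  | _ => simp [filled, Mem.stacks, hS, hL]

open Polynomial in
/-- The final value of the flag is the decision. The stacks that remain are arbitrary. -/
theorem Prog.within_evaluate {c : Cmd} {φ : Fm} (hc : c.Fresh ∅) (hφ : φ.Fresh ∅) :
    ∃ T : ℕ[X], ∀ w, ∃ q o S, (q = true ↔ w ∈ c.language φ) ∧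
      Within (evaluate c φ) (start w) ((q, o), S) (T.eval w.length) := by
  classical
  obtain ⟨P, hP⟩ := Cmd.within_prog hc
  obtain ⟨Q, hQ⟩ := Fm.within_prog hφ
  refine ⟨4 * X + 1 + (X * (X * 11 + 9) + 8 + 1 + (1 + (P + Q) + 1)), fun w => ?_⟩
  simp only [eval_add, eval_mul, eval_X, eval_one, eval_ofNat]
  obtain ⟨q, n, bits, hw, h⟩ := within_parse w (start w).2 none rfl
  cases q with
  | false =>
    refine ⟨false, none, _, ?_, h.seq (Within.seq
      (within_ite (fun h => by simp at h) (fun _ => (within_skip _).mono ?_))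
      (within_ite (fun h => by simp at h) (fun _ => (within_skip _).mono ?_)))⟩
    · simp only [Bool.false_eq_true, false_iff]
      rintro ⟨m, -, R, hR, -⟩
      have : false ∈ List.replicate n true := by
        simp only [Bool.false_eq_true, if_false, List.append_nil] at hw
        rw [← hw, hR]
        simp
      simp at this
    · omega
    · omega
  | true =>
    simp only [if_true] at hw
    have hn : n ≤ w.length := by rw [hw]; simp
    have hmem (m : ℕ) (R : Fin m → Fin m → Bool)
        (hR : w = List.replicate m true ++ false :: matrixBits R) :
        n = m ∧ bits = matrixBits R := unary_append_inj (hw.symm.trans hR)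
    set S₁ : Stacks := Function.update (Function.update (Function.update (start w).2
        .inp []) .size (List.replicate n true ++ (start w).2 .size)) .scratch
        (bits.reverse ++ (start w).2 .scratch) with hS₁
    have hscr : S₁ .scratch = bits.reverse := by simp [hS₁, start]
    obtain ⟨o', S', h', hS'⟩ := within_fill (S := S₁) (n := n) true none (by simp [hS₁, start])
      (by simp [hS₁, start]) (by simp [hS₁, start]) (by simp [hS₁, start])
    have hfill : n * (n * 11 + 9) + 8 ≤ w.length * (w.length * 11 + 9) + 8 := by gcongr
    simp only [hscr, List.length_reverse, Bool.true_and] at h' hS'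
    by_cases hgood : bits.length = n * n ∧ 0 < n
    · obtain ⟨hlen, hpos⟩ := hgood
      obtain ⟨R, rfl⟩ := matrixBits_surjective hlen
      replace hS' := (hS' hlen hpos).trans
        (filled_eq_stacks (n := n) R (S := S₁) (L := (matrixBits R).reverse)
          (fun k hk => by cases k <;> simp_all [start]) (by simp))
      simp only [hlen, hpos, decide_true, Bool.and_true] at h'
      subst hS'
      obtain ⟨o₁, h₁⟩ := hP n (Mem.initial R) (fun _ => ⟨0, hpos⟩) (fun _ => 0)
        (fun _ _ => ⟨rfl, rfl⟩) none
      have h₂ := hQ n (c.run (fun _ => ⟨0, hpos⟩) (Mem.initial R)) (fun _ => ⟨0, hpos⟩)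
        (fun _ => 0) (fun _ _ => ⟨rfl, rfl⟩) false o₁ _ decide_eq_true_iff
      have hPn := P.eval_mono_nat hn
      have hQn := Q.eval_mono_nat hn
      refine ⟨_, none, _, ?_, h.seq (Within.seq
        (within_ite (fun _ => h'.mono hfill) (fun h => by simp at h))
        (within_ite (fun _ => ((within_load _ _ _).seq (h₁.seq h₂)).mono ?_)
        (fun h => by simp at h)))⟩
      · rw [decide_eq_true_iff]
        constructor
        · exact fun hφ => ⟨n, hpos, R, hw, hφ⟩
        · rintro ⟨m, hm, R', hR', hφ⟩
          obtain ⟨rfl, hRR⟩ := hmem m R' hR'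
          obtain rfl := matrixBits_injective hRR
          exact hφ
      · omega
    · have hfalse : (decide (bits.length = n * n) && decide (0 < n)) = false := by
        simpa using hgood
      rw [hfalse] at h'
      refine ⟨false, o', S', ?_, h.seq (Within.seq
        (within_ite (fun _ => h'.mono hfill) (fun h => by simp at h))
        (within_ite (fun h => by simp at h) (fun _ => (within_skip _).mono ?_)))⟩
      · simp only [Bool.false_eq_true, false_iff]
        rintro ⟨m, hm, R, hR, -⟩
        obtain ⟨rfl, rfl⟩ := hmem m R hR
        exact hgood ⟨by simp, hm⟩
      · omega

open Polynomial in
/-- What a command and a formula decide is decided in polynomial time. -/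
theorem Cmd.inP_language {c : Cmd} {φ : Fm} (hc : c.Fresh ∅) (hφ : φ.Fresh ∅) :
    InP (c.language φ) := by
  classical
  obtain ⟨T, hT⟩ := Prog.within_evaluate hc hφ
  refine Prog.inP_of_exec _ (Prog.decider c φ)
    (T + (C (Finset.univ.toList : List Stk).length * ((X + T) * 2 + 1) + 1 + (1 + 1)))
    fun w => ?_
  obtain ⟨q, o, S, hq, t, ht, hE⟩ := hT w
  have hS (k : Stk) : (S k).length ≤ w.length + T.eval w.length := by
    refine (hE.length_le k).trans (add_le_add ?_ ht)
    simp only [Prog.start]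
    split_ifs <;> simp
  obtain ⟨o', h⟩ := Prog.within_clear_list Finset.univ.toList S q o _ hS
  have h1 := (Prog.Within.seq ⟨t, ht, hE⟩ (h.seq ((Prog.within_push .out (fun v => v.1) _ _).seq
    (Prog.within_load (fun _ => (false, none)) _ _))))
  refine h1.congr rfl rfl rfl ?_ ?_
  · funext z
    have : decide (w ∈ c.language φ) = q := by rw [Bool.eq_iff_iff]; simp [hq]
    by_cases hz : z = .out
    · subst hz; simp [this]
    · simp [hz]
  · simp

/-! ### Decompositions of cubic graphs into claws and triangles -/

namespace SimpleGraph

variable {V : Type} {G : SimpleGraph V}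

/-- The vertices `u` and `v` are the two vertices of degree two of an induced diamond, that is, of
a complete graph on four vertices without the edge between `u` and `v`. -/
def Opposite (G : SimpleGraph V) (u v : V) : Prop :=
  u ≠ v ∧ ¬ G.Adj u v ∧ ∃ a b, G.Adj a b ∧ G.Adj u a ∧ G.Adj u b ∧ G.Adj v a ∧ G.Adj v b

/-- Exactly one of `u` and `v` has to be the center of a claw: they are adjacent and not in a common
triangle, or opposite in a diamond. -/
def Differ (G : SimpleGraph V) (u v : V) : Prop :=
  (G.Adj u v ∧ ¬ ∃ c, G.Adj u c ∧ G.Adj v c) ∨ G.Opposite u v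

/-- The vertex `u` cannot be the center of a claw: it is in a triangle and has no opposite. -/
def Excluded (G : SimpleGraph V) (u : V) : Prop :=
  (∃ a b, G.Adj a b ∧ G.Adj u a ∧ G.Adj u b) ∧ ¬ ∃ v, G.Opposite u v

/-- The set `x` satisfies the constraints on the set of centers. -/
structure IsSolution (G : SimpleGraph V) (x : V → Prop) : Prop where
  differ : ∀ u v, G.Differ u v → (x u ↔ ¬ x v)
  excluded : ∀ u, G.Excluded u → ¬ x u

/-- The set `x` is the set of centers of the claws of a decomposition of a cubic graph: it is
independent, and the edges that do not meet it are partitioned by the triangles that do not. -/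
structure IsCenterSet (G : SimpleGraph V) (x : V → Prop) : Prop where
  indep : ∀ u v, G.Adj u v → x u → ¬ x v
  triangle : ∀ u v, G.Adj u v → ¬ x u → ¬ x v → ∃! c, G.Adj u c ∧ G.Adj v c ∧ ¬ x c

/-- Every vertex has exactly three neighbors. -/
def HasThreeNeighbors (G : SimpleGraph V) : Prop :=
  ∀ v, ∃ a b c, a ≠ b ∧ a ≠ c ∧ b ≠ c ∧ ∀ w, G.Adj v w ↔ w = a ∨ w = b ∨ w = c

theorem HasThreeNeighbors.eq_or {v a b c d : V} (hG : G.HasThreeNeighbors) (ha : G.Adj v a)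
    (hb : G.Adj v b) (hc : G.Adj v c) (hab : a ≠ b) (hac : a ≠ c) (hbc : b ≠ c)
    (hd : G.Adj v d) : d = a ∨ d = b ∨ d = c := by
  obtain ⟨p, q, r, -, -, -, h⟩ := hG v
  rw [h] at ha hb hc hd
  grind

theorem Opposite.symm {u v : V} (h : G.Opposite u v) : G.Opposite v u := by
  obtain ⟨h1, h2, a, b, h3, h4, h5, h6, h7⟩ := h
  exact ⟨h1.symm, fun h => h2 h.symm, a, b, h3, h6, h7, h4, h5⟩

theorem Differ.symm {u v : V} (h : G.Differ u v) : G.Differ v u := by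
  rcases h with ⟨h1, h2⟩ | h
  · exact .inl ⟨h1.symm, fun ⟨c, h3, h4⟩ => h2 ⟨c, h4, h3⟩⟩
  · exact .inr h.symm

/-- The only triangle at a vertex that has an opposite is the one in the diamond. -/
theorem Opposite.of_triangle {u v a b : V} (hG : G.HasThreeNeighbors) (h : G.Opposite u v)
    (hab : G.Adj a b) (ha : G.Adj u a) (hb : G.Adj u b) : G.Adj v a ∧ G.Adj v b := by
  obtain ⟨h1, h2, p, q, h3, h4, h5, h6, h7⟩ := h
  have ha' := hab.ne
  have hp := h3.ne
  have hup := fun z => hG.eq_or (d := z) h3 h4.symm h6.symm h5.ne' h7.ne' h1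
  have huq := fun z => hG.eq_or (d := z) h3.symm h5.symm h7.symm h4.ne' h6.ne' h1
  by_cases hap : a = p
  · subst hap
    rcases hup b hab with rfl | rfl | rfl
    · exact ⟨h6, h7⟩
    · exact absurd hb (G.irrefl)
    · exact absurd hb h2
  · by_cases haq : a = q
    · subst haq
      rcases huq b hab with rfl | rfl | rfl
      · exact ⟨h7, h6⟩
      · exact absurd hb (G.irrefl)
      · exact absurd hb h2
    · rcases hG.eq_or h4 h5 ha hp (Ne.symm hap) (Ne.symm haq) hb with rfl | rfl | rfl
      · rcases hup a hab.symm with rfl | rfl | rfl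
        · exact absurd rfl haq
        · exact absurd ha (G.irrefl)
        · exact absurd ha h2
      · rcases huq a hab.symm with rfl | rfl | rfl
        · exact absurd rfl hap
        · exact absurd ha (G.irrefl)
        · exact absurd ha h2
      · exact absurd rfl ha'

/-- The four vertices are pairwise adjacent. -/
def IsK4 (G : SimpleGraph V) (a b c d : V) : Prop :=
  G.Adj a b ∧ G.Adj a c ∧ G.Adj a d ∧ G.Adj b c ∧ G.Adj b d ∧ G.Adj c d

/-- The constraints are necessary: a vertex of degree three of a diamond cannot be a center, so that
the middle edge of the diamond is in the triangle of one of the two opposite vertices, and the other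
one is a center. A triangle at a center meets no other center, so that the edge opposite to the
center has to be in a second triangle. -/
theorem IsCenterSet.isSolution {x : V → Prop} (hG : G.HasThreeNeighbors)
    (hK : ∀ a b c d, ¬ G.IsK4 a b c d) (hx : G.IsCenterSet x) : G.IsSolution x := by
  have hopp : ∀ {a b u v}, G.Adj a b → G.Adj a u → G.Adj b u → G.Adj a v → G.Adj b v → u ≠ v →
      G.Opposite u v := fun {a b u v} h1 h2 h3 h4 h5 h6 =>
    ⟨h6, fun h => hK a b u v ⟨h1, h2, h4, h3, h5, h⟩, a, b, h1, h2.symm, h3.symm, h4.symm, h5.symm⟩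
  -- a vertex of degree three of a diamond is not a center
  have hmid : ∀ {a b u v}, G.Adj a b → G.Adj a u → G.Adj b u → G.Adj a v → G.Adj b v → u ≠ v →
      ¬ G.Adj u v → ¬ x a := by
    intro a b u v h1 h2 h3 h4 h5 h6 h7 ha
    obtain ⟨c, ⟨hc1, hc2, hc3⟩, -⟩ := hx.triangle b u h3 (hx.indep a b h1 ha) (hx.indep a u h2 ha)
    rcases hG.eq_or h1.symm h3 h5 h2.ne h4.ne h6 hc1 with rfl | rfl | rfl
    · exact hc3 ha
    · exact G.irrefl hc2
    · exact h7 hc2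
  refine ⟨fun u v h => ?_, fun u h hu => ?_⟩
  · rcases h with ⟨h1, h2⟩ | ⟨h1, h2, a, b, h3, h4, h5, h6, h7⟩
    · refine ⟨hx.indep u v h1, fun hv => by_contra fun hu => h2 ?_⟩
      obtain ⟨c, ⟨hc1, hc2, -⟩, -⟩ := hx.triangle u v h1 hu hv
      exact ⟨c, hc1, hc2⟩
    · have ha := hmid h3 h4.symm h5.symm h6.symm h7.symm h1 h2
      have hb := hmid h3.symm h5.symm h4.symm h7.symm h6.symm h1 h2
      obtain ⟨c, ⟨hc1, hc2, hc3⟩, hc⟩ := hx.triangle a b h3 ha hb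
      constructor
      · intro hu hv
        rcases hG.eq_or h3 h4.symm h6.symm h5.ne' h7.ne' h1 hc1 with rfl | rfl | rfl
        · exact G.irrefl hc2
        · exact hc3 hu
        · exact hc3 hv
      · intro hv
        by_contra hu
        exact h1 ((hc u ⟨h4.symm, h5.symm, hu⟩).trans (hc v ⟨h6.symm, h7.symm, hv⟩).symm)
  · obtain ⟨⟨a, b, h1, h2, h3⟩, h4⟩ := h
    obtain ⟨c, ⟨hc1, hc2, hc3⟩, -⟩ := hx.triangle a b h1 (hx.indep u a h2 hu) (hx.indep u b h3 hu)
    exact h4 ⟨c, hopp h1 h2.symm h3.symm hc1 hc2 fun h => hc3 (h ▸ hu)⟩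

/-- The constraints are sufficient: an edge in no triangle has exactly one center; an edge in a
triangle whose ends are no centers is in a unique triangle without centers, as of the two triangles
at the middle edge of a diamond exactly one has a center. -/
theorem IsSolution.isCenterSet {x : V → Prop} (hG : G.HasThreeNeighbors)
    (hK : ∀ a b c d, ¬ G.IsK4 a b c d) (hx : G.IsSolution x) : G.IsCenterSet x := by
  -- a center in a triangle has an opposite, which is adjacent to the rest of the triangle
  have hcen : ∀ {a b c}, G.Adj a b → G.Adj c a → G.Adj c b → x c →
      ∃ d, G.Opposite c d ∧ G.Adj d a ∧ G.Adj d b := by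
    intro a b c h1 h2 h3 hc
    by_contra! h
    refine hx.excluded c ⟨⟨a, b, h1, h2, h3⟩, fun ⟨d, hd⟩ => ?_⟩ hc
    have := hd.of_triangle hG h1 h2 h3
    exact h d hd this.1 this.2
  refine ⟨fun u v h hu hv => ?_, fun u v h hu hv => ?_⟩
  · by_cases hc : ∃ c, G.Adj u c ∧ G.Adj v c
    · obtain ⟨c, h1, h2⟩ := hc
      obtain ⟨d, h3, h4, h5⟩ := hcen h2 h h1 hu
      obtain ⟨e, h6, h7, h8⟩ := hcen h1 h.symm h2 hv
      rcases hG.eq_or h1.symm h2.symm h5.symm h.ne h3.1 h4.ne' h8.symm with rfl | rfl | rfl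
      · exact G.irrefl h7
      · exact h6.1 rfl
      · exact h3.2.1 h7.symm
    · exact (hx.differ u v (.inl ⟨h, hc⟩)).1 hu hv
  · by_cases hc : ∃ c, G.Adj u c ∧ G.Adj v c
    · obtain ⟨c, h1, h2⟩ := hc
      by_cases hd : ∃ d, d ≠ c ∧ G.Adj u d ∧ G.Adj v d
      · obtain ⟨d, h3, h4, h5⟩ := hd
        have hopp : G.Opposite c d := ⟨h3.symm, fun h' => hK u v c d ⟨h, h1, h4, h2, h5, h'⟩, u, v,
          h, h1.symm, h2.symm, h4.symm, h5.symm⟩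
        have hiff := hx.differ c d (.inr hopp)
        have hall := fun z => hG.eq_or (d := z) h h1 h4 h2.ne h5.ne h3.symm
        by_cases hxc : x c
        · exact ⟨d, ⟨h4, h5, hiff.1 hxc⟩, fun z hz => by
            rcases hall z hz.1 with rfl | rfl | rfl
            · exact absurd hz.2.1 G.irrefl
            · exact absurd hxc hz.2.2
            · rfl⟩
        · exact ⟨c, ⟨h1, h2, hxc⟩, fun z hz => by
            rcases hall z hz.1 with rfl | rfl | rfl
            · exact absurd hz.2.1 G.irrefl
            · rfl
            · exact absurd (hiff.2 hz.2.2) hxc⟩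
      · push Not at hd
        refine ⟨c, ⟨h1, h2, fun hxc => ?_⟩, fun z hz => by_contra fun h' => hd z h' hz.1 hz.2.1⟩
        obtain ⟨d, h3, h4, h5⟩ := hcen h h1.symm h2.symm hxc
        exact hd d h3.1.symm h4.symm h5.symm
    · exact absurd ((hx.differ u v (.inl ⟨h, hc⟩)).2 hv) hu

/-- A connected cubic graph with a complete subgraph on four vertices has no other vertices. -/
theorem IsK4.eq_or {a b c d : V} (h : G.IsK4 a b c d) (hG : G.HasThreeNeighbors)
    (hc : G.Preconnected) (v : V) : v = a ∨ v = b ∨ v = c ∨ v = d := by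
  obtain ⟨h1, h2, h3, h4, h5, h6⟩ := h
  have ha := fun z => hG.eq_or (d := z) h1 h2 h3 h4.ne h5.ne h6.ne
  have hb := fun z => hG.eq_or (d := z) h1.symm h4 h5 h2.ne h3.ne h6.ne
  have hc' := fun z => hG.eq_or (d := z) h2.symm h4.symm h6 h1.ne h3.ne h5.ne
  have hd := fun z => hG.eq_or (d := z) h3.symm h5.symm h6.symm h1.ne h2.ne h4.ne
  obtain ⟨p⟩ := hc a v
  suffices ∀ u v (_ : G.Walk u v), (u = a ∨ u = b ∨ u = c ∨ u = d) →
      (v = a ∨ v = b ∨ v = c ∨ v = d) from this a v p (.inl rfl)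
  intro u v p hu
  induction p with
  | nil => exact hu
  | cons h _ ih =>
    refine ih ?_
    rcases hu with rfl | rfl | rfl | rfl
    · exact .inr (ha _ h)
    · rcases hb _ h with h | h | h <;> simp [h]
    · rcases hc' _ h with h | h | h <;> simp [h]
    · rcases hd _ h with h | h | h <;> simp [h]

theorem IsK4.adj {a b c d u v : V} (h : G.IsK4 a b c d) (hG : G.HasThreeNeighbors)
    (hc : G.Preconnected) (huv : u ≠ v) : G.Adj u v := by
  have hall := h.eq_or hG hc
  obtain ⟨h1, h2, h3, h4, h5, h6⟩ := h
  rcases hall u with rfl | rfl | rfl | rfl <;> rcases hall v with rfl | rfl | rfl | rfl <;>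
    first | assumption | exact absurd rfl huv | (apply SimpleGraph.Adj.symm; assumption)

/-- In the complete graph on four vertices no two values have to differ, so that the empty set is a
solution. -/
theorem IsK4.isSolution {a b c d : V} (h : G.IsK4 a b c d) (hG : G.HasThreeNeighbors)
    (hc : G.Preconnected) : G.IsSolution fun _ => False := by
  have hadj {u v} (huv : u ≠ v) := h.adj hG hc huv
  obtain ⟨h1, h2, -, h4, -, -⟩ := h
  refine ⟨fun u v h => ?_, fun _ _ h => h⟩
  rcases h with ⟨h, h'⟩ | ⟨h, h', -⟩
  · obtain ⟨w, hu, hv⟩ : ∃ w, w ≠ u ∧ w ≠ v := by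
      by_contra! hw
      have hw z := or_iff_not_imp_left.2 (hw z)
      have := hw a
      have := hw b
      have := hw c
      have := h1.ne
      have := h2.ne
      have := h4.ne
      clear hadj h1 h2 h4
      grind
    exact absurd ⟨w, hadj hu.symm, hadj hv.symm⟩ h'
  · exact absurd (hadj h) h'

/-- The complete graph on four vertices is the union of a claw and a triangle. -/
theorem IsK4.isCenterSet {a b c d : V} (h : G.IsK4 a b c d) (hG : G.HasThreeNeighbors)
    (hc : G.Preconnected) : G.IsCenterSet fun v => v = a := by
  have hadj {u v} (huv : u ≠ v) := h.adj hG hc huv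
  have hall := h.eq_or hG hc
  obtain ⟨h1, h2, h3, h4, h5, h6⟩ := h
  refine ⟨fun u v h hu hv => G.ne_of_adj h (hu.trans hv.symm), fun u v h hu hv => ?_⟩
  have huv := h.ne
  have n1 := h1.ne
  have n2 := h2.ne
  have n3 := h3.ne
  have n4 := h4.ne
  have n5 := h5.ne
  have n6 := h6.ne
  have hu' := hall u
  have hv' := hall v
  obtain ⟨r, hru, hrv, hra⟩ : ∃ r, r ≠ u ∧ r ≠ v ∧ r ≠ a := by
    by_contra! hr
    have hr z : z = u ∨ z = v ∨ z = a := by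
      by_contra! h
      exact h.2.2 (hr z h.1 h.2.1)
    have := hr b
    have := hr c
    have := hr d
    clear hadj h1 h2 h3 h4 h5 h6 hr
    grind
  refine ⟨r, ⟨hadj hru.symm, hadj hrv.symm, hra⟩, fun z ⟨hz1, hz2, hz3⟩ => ?_⟩
  have := hz1.ne
  have := hz2.ne
  have := hall r
  have := hall z
  clear hadj h1 h2 h3 h4 h5 h6 hz1 hz2 h
  grind

/-- The complete graph on four vertices is the only connected cubic graph in which solutions and
sets of centers differ, but both exist there. -/
theorem exists_isCenterSet_iff (hG : G.HasThreeNeighbors) (hc : G.Preconnected) :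
    (∃ x, G.IsCenterSet x) ↔ ∃ x, G.IsSolution x := by
  by_cases hK : ∃ a b c d, G.IsK4 a b c d
  · obtain ⟨a, b, c, d, h⟩ := hK
    exact iff_of_true ⟨_, h.isCenterSet hG hc⟩ ⟨_, h.isSolution hG hc⟩
  · push Not at hK
    exact ⟨fun ⟨x, hx⟩ => ⟨x, hx.isSolution hG hK⟩, fun ⟨x, hx⟩ => ⟨x, hx.isCenterSet hG hK⟩⟩

/-! ### Decompositions and sets of centers -/

/-- Isomorphisms from a subgraph to `F` are embeddings of `F` with the subgraph as their image. -/
theorem Subgraph.nonempty_iso_iff {W : Type} {F : SimpleGraph W} {H : G.Subgraph} :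
    Nonempty (H.coe ≃g F) ↔ ∃ f : W → V, Function.Injective f ∧ Set.range f = H.verts ∧
      ∀ i j, H.Adj (f i) (f j) ↔ F.Adj i j := by
  constructor
  · rintro ⟨e⟩
    refine ⟨fun i => e.symm i, Subtype.val_injective.comp e.symm.injective, ?_, fun i j => ?_⟩
    · ext v
      exact ⟨fun ⟨i, hi⟩ => hi ▸ (e.symm i).2, fun hv => ⟨e ⟨v, hv⟩, by simp⟩⟩
    · rw [← e.symm.map_rel_iff]
      rfl
  · rintro ⟨f, hf, hr, hadj⟩
    have hmem i : f i ∈ H.verts := hr ▸ Set.mem_range_self i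
    have hb : Function.Bijective fun i => (⟨f i, hmem i⟩ : H.verts) := by
      refine ⟨fun i j h => hf (congrArg Subtype.val h), fun ⟨v, hv⟩ => ?_⟩
      obtain ⟨i, rfl⟩ : v ∈ Set.range f := hr ▸ hv
      exact ⟨i, rfl⟩
    exact ⟨(RelIso.mk (Equiv.ofBijective _ hb) (fun {i j} => hadj i j) : F ≃g H.coe).symm⟩

/-- The subgraph `H` consists of the edges at the vertex `v`. -/
def Subgraph.IsStar (H : G.Subgraph) (v : V) : Prop :=
  (∀ w, G.Adj v w → H.Adj v w) ∧ ∀ p q, H.Adj p q → p = v ∨ q = v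

/-- The vertices `a`, `b`, `c` span a triangle, and `H` has no other edges. -/
def Subgraph.IsTriangle (H : G.Subgraph) (a b c : V) : Prop :=
  H.Adj a b ∧ H.Adj a c ∧ H.Adj b c ∧
    ∀ p q, H.Adj p q → (p = a ∨ p = b ∨ p = c) ∧ (q = a ∨ q = b ∨ q = c)

/-- As the degrees are three, a claw contains all edges at its center. -/
theorem Subgraph.isStar_of_iso (hG : G.HasThreeNeighbors) {H : G.Subgraph}
    (h : Nonempty (H.coe ≃g clawGraph.2)) : ∃ v, H.IsStar v := by
  obtain ⟨f, hf, hr, hadj⟩ := nonempty_iso_iff.1 h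
  have hstar i : H.Adj (f (.inl 0)) (f (.inr i)) := by rw [hadj]; simp
  refine ⟨f (.inl 0), fun w hw => ?_, fun p q hpq => ?_⟩
  · rcases hG.eq_or (hstar 0).adj_sub (hstar 1).adj_sub (hstar 2).adj_sub (hf.ne (by simp))
      (hf.ne (by simp)) (hf.ne (by simp)) hw with rfl | rfl | rfl <;> exact hstar _
  · obtain ⟨i, rfl⟩ : p ∈ Set.range f := hr ▸ hpq.fst_mem
    obtain ⟨j, rfl⟩ : q ∈ Set.range f := hr ▸ hpq.snd_mem
    rw [hadj] at hpq
    rcases i with i | i <;> rcases j with j | j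
    · exact .inl (by rw [Subsingleton.elim i 0])
    · exact .inl (by rw [Subsingleton.elim i 0])
    · exact .inr (by rw [Subsingleton.elim j 0])
    · simp at hpq

theorem Subgraph.isTriangle_of_iso {H : G.Subgraph} (h : Nonempty (H.coe ≃g triangleGraph.2)) :
    ∃ a b c, H.IsTriangle a b c := by
  obtain ⟨f, hf, hr, hadj⟩ := nonempty_iso_iff.1 h
  have key : ∀ p ∈ H.verts, p = f 0 ∨ p = f 1 ∨ p = f 2 := by
    intro p hp
    obtain ⟨i, rfl⟩ : p ∈ Set.range f := hr ▸ hp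
    fin_cases i <;> simp
  exact ⟨f 0, f 1, f 2, (hadj _ _).2 (by simp), (hadj _ _).2 (by simp), (hadj _ _).2 (by simp),
    fun p q hpq => ⟨key p hpq.fst_mem, key q hpq.snd_mem⟩⟩

/-- The third vertex of a triangle with a given edge. -/
theorem Subgraph.IsTriangle.exists_third {H : G.Subgraph} {a b c u v : V}
    (h : H.IsTriangle a b c) (huv : H.Adj u v) : ∃ w, H.IsTriangle u v w := by
  obtain ⟨h1, h2, h3, h4⟩ := h
  have huv' := huv.ne
  obtain ⟨hu, hv⟩ := h4 u v huv
  have s1 := h1.symm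
  have s2 := h2.symm
  have s3 := h3.symm
  rcases hu with rfl | rfl | rfl <;> rcases hv with rfl | rfl | rfl <;>
    first
    | exact absurd rfl huv'
    | exact ⟨a, by assumption, by assumption, by assumption, by grind⟩
    | exact ⟨b, by assumption, by assumption, by assumption, by grind⟩
    | exact ⟨c, by assumption, by assumption, by assumption, by grind⟩

/-- The centers of the claws of a decomposition form a set of centers. -/
theorem exists_isCenterSet_of_isDecomposable (hG : G.HasThreeNeighbors)
    (h : IsDecomposable {clawGraph, triangleGraph} G) : ∃ x, G.IsCenterSet x := by
  obtain ⟨D, hiso, hcover⟩ := h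
  have hD : ∀ H ∈ D, (∃ v, H.IsStar v) ∨ ∃ a b c, H.IsTriangle a b c := by
    intro H hH
    obtain ⟨F, rfl | rfl, h⟩ := hiso H hH
    · exact .inl (Subgraph.isStar_of_iso hG h)
    · exact .inr (Subgraph.isTriangle_of_iso h)
  have hex : ∀ u v, G.Adj u v → ∃ H ∈ D, H.Adj u v := fun u v huv =>
    let ⟨H, h, _⟩ := hcover s(u, v) huv
    ⟨H, h.1, h.2⟩
  have hun : ∀ {H H' : G.Subgraph} {u v}, H ∈ D → H' ∈ D → H.Adj u v → H'.Adj u v → H = H' :=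
    fun h h' ha ha' => (hcover s(_, _) ha.adj_sub).unique ⟨h, ha⟩ ⟨h', ha'⟩
  -- an edge that does not meet the centers is in a triangle
  have htri : ∀ u v, G.Adj u v → (¬ ∃ H ∈ D, H.IsStar u) → (¬ ∃ H ∈ D, H.IsStar v) →
      ∃ H ∈ D, ∃ w, H.IsTriangle u v w := by
    intro u v huv hu hv
    obtain ⟨H, hH, hadj⟩ := hex u v huv
    rcases hD H hH with ⟨w, hw⟩ | ⟨a, b, c, h⟩
    · rcases hw.2 u v hadj with rfl | rfl
      · exact absurd ⟨H, hH, hw⟩ hu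
      · exact absurd ⟨H, hH, hw⟩ hv
    · exact ⟨H, hH, h.exists_third hadj⟩
  refine ⟨fun v => ∃ H ∈ D, H.IsStar v, ?_, ?_⟩
  · rintro u v huv ⟨H, hH, hu⟩ ⟨H', hH', hv⟩
    obtain rfl := hun hH hH' (hu.1 v huv) (hv.1 u huv.symm).symm
    obtain ⟨a, b, c, hab, -, -, hv'⟩ := hG v
    have ha := hu.2 v a (hv.1 a ((hv' a).2 (by simp)))
    have hb := hu.2 v b (hv.1 b ((hv' b).2 (by simp)))
    exact hab ((ha.resolve_left huv.ne').trans (hb.resolve_left huv.ne').symm)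
  · intro u v huv hu hv
    obtain ⟨H, hH, w, hT⟩ := htri u v huv hu hv
    refine ⟨w, ⟨hT.2.1.adj_sub, hT.2.2.1.adj_sub, ?_⟩, ?_⟩
    · rintro ⟨H', hH', hw⟩
      obtain rfl := hun hH hH' hT.2.1 (hw.1 u hT.2.1.adj_sub.symm).symm
      rcases hw.2 u v hT.1 with h | h
      · exact hT.2.1.ne h
      · exact hT.2.2.1.ne h
    · rintro z ⟨hz1, hz2, hz⟩
      by_contra hzw
      have hz' := hz1.ne'
      have hz'' := hz2.ne'
      have hnot : ¬ H.Adj u z := fun h => by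
        rcases (hT.2.2.2 u z h).2 with h | h | h
        exacts [hz' h, hz'' h, hzw h]
      obtain ⟨H', hH', y, hT'⟩ := htri u z hz1 hu hz
      rcases hG.eq_or huv hT.2.1.adj_sub hz1 hT.2.2.1.ne hz''.symm (Ne.symm hzw)
        hT'.2.1.adj_sub with rfl | rfl | rfl
      · exact hnot (hun hH' hH hT'.2.1 hT.1 ▸ hT'.1)
      · exact hnot (hun hH' hH hT'.2.1 hT.2.1 ▸ hT'.1)
      · exact hT'.2.2.1.ne rfl

/-- The subgraph of the edges at `v`. -/
def star (G : SimpleGraph V) (v : V) : G.Subgraph where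
  verts := {w | w = v ∨ G.Adj v w}
  Adj p q := G.Adj p q ∧ (p = v ∨ q = v)
  adj_sub h := h.1
  edge_vert {p q} h := by
    rcases h with ⟨h, rfl | rfl⟩
    · exact .inl rfl
    · exact .inr h.symm
  symm := ⟨fun p q h => ⟨h.1.symm, h.2.symm⟩⟩

theorem nonempty_star_iso (hG : G.HasThreeNeighbors) (v : V) :
    Nonempty ((G.star v).coe ≃g clawGraph.2) := by
  obtain ⟨a, b, c, hab, hac, hbc, hv⟩ := hG v
  have ha := (hv a).2 (by simp)
  have hb := (hv b).2 (by simp)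
  have hc := (hv c).2 (by simp)
  have na := ha.ne
  have nb := hb.ne
  have nc := hc.ne
  rw [Subgraph.nonempty_iso_iff]
  refine ⟨Sum.elim (fun _ => v) ![a, b, c], ?_, ?_, ?_⟩
  · rintro (i | i) (j | j) h
    · rw [Subsingleton.elim i j]
    · fin_cases j <;> simp_all
    · fin_cases i <;> simp_all
    · fin_cases i <;> fin_cases j <;> simp_all
  · ext w
    simp only [Set.Sum.elim_range, star, hv]
    simp [eq_comm]
    tauto
  · rintro (i | i) (j | j)
    · simp [star]
    · fin_cases j <;> simp [star, ha, hb, hc]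
    · fin_cases i <;> simp [star, ha.symm, hb.symm, hc.symm]
    · fin_cases i <;> fin_cases j <;> simp [star, na.symm, nb.symm, nc.symm]

theorem nonempty_triangle_iso {a b c : V} (hab : G.Adj a b) (hac : G.Adj a c) (hbc : G.Adj b c) :
    Nonempty (((⊤ : G.Subgraph).induce {a, b, c}).coe ≃g triangleGraph.2) := by
  have nab := hab.ne
  have nac := hac.ne
  have nbc := hbc.ne
  rw [Subgraph.nonempty_iso_iff]
  refine ⟨![a, b, c], ?_, ?_, ?_⟩
  · intro i j h
    fin_cases i <;> fin_cases j <;> simp_all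
  · ext w
    simp [eq_comm]
    tauto
  · intro i j
    fin_cases i <;> fin_cases j <;> simp [hab, hac, hbc, hab.symm, hac.symm, hbc.symm]

/-- The claws at the centers and the triangles without centers form a decomposition. -/
theorem IsCenterSet.isDecomposable (hG : G.HasThreeNeighbors) {x : V → Prop}
    (hx : G.IsCenterSet x) : IsDecomposable {clawGraph, triangleGraph} G := by
  refine ⟨{H | (∃ v, x v ∧ H = G.star v) ∨ ∃ a b c, G.Adj a b ∧ G.Adj a c ∧ G.Adj b c ∧
    ¬ x a ∧ ¬ x b ∧ ¬ x c ∧ H = (⊤ : G.Subgraph).induce {a, b, c}}, ?_, ?_⟩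
  · rintro H (⟨v, -, rfl⟩ | ⟨a, b, c, hab, hac, hbc, -, -, -, rfl⟩)
    · exact ⟨clawGraph, by simp, nonempty_star_iso hG v⟩
    · exact ⟨triangleGraph, by simp, nonempty_triangle_iso hab hac hbc⟩
  · -- an edge at a center is only in the claw of that center
    have hcen : ∀ u v, G.Adj u v → x u → ∃! H : G.Subgraph, ((∃ v, x v ∧ H = G.star v) ∨
        ∃ a b c, G.Adj a b ∧ G.Adj a c ∧ G.Adj b c ∧ ¬ x a ∧ ¬ x b ∧ ¬ x c ∧
        H = (⊤ : G.Subgraph).induce {a, b, c}) ∧ H.Adj u v := by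
      intro u v huv hu
      refine ⟨G.star u, ⟨.inl ⟨u, hu, rfl⟩, huv, .inl rfl⟩, ?_⟩
      rintro H ⟨⟨w, hw, rfl⟩ | ⟨a, b, c, -, -, -, ha, hb, hc, rfl⟩, h⟩
      · rcases h.2 with rfl | rfl
        · rfl
        · exact absurd hw (hx.indep u v huv hu)
      · rcases h.1 with rfl | rfl | rfl
        exacts [absurd hu ha, absurd hu hb, absurd hu hc]
    intro e he
    induction e using Sym2.ind with | _ u v
    rw [mem_edgeSet] at he
    simp only [Set.mem_ofPred_eq, Subgraph.mem_edgeSet]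
    by_cases hu : x u
    · exact hcen u v he hu
    by_cases hv : x v
    · simpa only [Subgraph.adj_comm] using hcen v u he.symm hv
    obtain ⟨c, ⟨h1, h2, h3⟩, hc⟩ := hx.triangle u v he hu hv
    refine ⟨(⊤ : G.Subgraph).induce {u, v, c}, ⟨.inr ⟨u, v, c, he, h1, h2, hu, hv, h3, rfl⟩,
      by simpa using he⟩, ?_⟩
    rintro H ⟨⟨w, hw, rfl⟩ | ⟨p, q, r, hpq, hpr, hqr, hp, hq, hr, rfl⟩, h⟩
    · rcases h.2 with rfl | rfl
      exacts [absurd hw hu, absurd hw hv]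
    · congr 1
      have huv := he.ne
      obtain ⟨hu', hv', -⟩ := h
      simp only [Set.mem_insert_iff, Set.mem_singleton_iff] at hu' hv'
      have hset : ∀ w, G.Adj u w → G.Adj v w → ¬ x w → (∀ z, (z = p ∨ z = q ∨ z = r) ↔
          (z = u ∨ z = v ∨ z = w)) → ({p, q, r} : Set V) = {u, v, c} := by
        intro w h4 h5 h6 h
        rw [← hc w ⟨h4, h5, h6⟩]
        ext z
        exact h z
      rcases hu' with hu' | hu' | hu' <;> rcases hv' with hv' | hv' | hv' <;>
        simp only [hu', hv'] at hset ⊢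
      · exact absurd (hu'.trans hv'.symm) huv
      · exact hset r hpr hqr hr (by tauto)
      · exact hset q hpq hqr.symm hq (by tauto)
      · exact hset r hqr hpr hr (by tauto)
      · exact absurd (hu'.trans hv'.symm) huv
      · exact hset p hpq.symm hpr.symm hp (by tauto)
      · exact hset q hqr.symm hpq hq (by tauto)
      · exact hset p hpr.symm hpq.symm hp (by tauto)
      · exact absurd (hu'.trans hv'.symm) huv

/-- A connected cubic graph has a decomposition if and only if the constraints on the set of
centers can be satisfied. -/
theorem isDecomposable_iff (hG : G.HasThreeNeighbors) (hc : G.Preconnected) :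
    IsDecomposable {clawGraph, triangleGraph} G ↔ ∃ x, G.IsSolution x :=
  Iff.trans ⟨exists_isCenterSet_of_isDecomposable hG, fun ⟨_, hx⟩ => hx.isDecomposable hG⟩
    (exists_isCenterSet_iff hG hc)

end SimpleGraph

/-! ### The decision procedure -/

/-- The disjunction of two formulas. -/
def Fm.or (φ ψ : Fm) : Fm := .not (.and (.not φ) (.not ψ))

/-- The universal quantifier. -/
def Fm.all (x : Var) (φ : Fm) : Fm := .not (.ex x (.not φ))

@[simp]
theorem Fm.holds_or {n : ℕ} (A : Mem n) (φ ψ : Fm) (e : Var → Fin n) :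
    (φ.or ψ).Holds A e ↔ φ.Holds A e ∨ ψ.Holds A e := by
  simp only [Fm.or, Holds]
  tauto

@[simp]
theorem Fm.holds_all {n : ℕ} (A : Mem n) (x : Var) (φ : Fm) (e : Var → Fin n) :
    (φ.all x).Holds A e ↔ ∀ i, φ.Holds A (Function.update e x i) := by
  simp [Fm.all, Holds]

/-- The relations that a command may change. -/
def Cmd.writes : Cmd → Finset RelSym
  | add a _ _ _ => {a}
  | seq c d => c.writes ∪ d.writes
  | loop _ c => c.writes

/-- Induction over the iterations of a loop, where `P i` is to hold before iteration `i`. -/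
theorem Cmd.loop_induction {n : ℕ} {x : Var} {c : Cmd} {e : Var → Fin n} {A : Mem n}
    (P : ℕ → Mem n → Prop) (h0 : P 0 A)
    (h : ∀ (i : Fin n) (B : Mem n), P i B → P (i + 1) (c.run (Function.update e x i) B)) :
    P n ((loop x c).run e A) := by
  have key : ∀ k ≤ n, P k (((List.finRange n).take k).foldl
      (fun A i => c.run (Function.update e x i) A) A) := by
    intro k hk
    induction k with
    | zero => simpa using h0
    | succ k ih =>
      rw [List.take_succ_eq_append_getElem (by simpa using hk), List.foldl_append]
      simpa using h ⟨k, hk⟩ _ (ih (Nat.le_of_succ_le hk))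
  have := key n le_rfl
  rwa [List.take_of_length_le (by simp)] at this

theorem Cmd.run_of_notMem_writes {n : ℕ} {c : Cmd} {a : RelSym} (h : a ∉ c.writes)
    (e : Var → Fin n) (A : Mem n) : c.run e A a = A a := by
  induction c generalizing e A with
  | add b x y φ =>
    simp only [run]
    split_ifs
    · exact A.insert_of_ne _ _ (by simpa [writes] using h)
    · rfl
  | seq c d ihc ihd =>
    simp only [writes, Finset.mem_union, not_or] at h
    simp only [run, ihd h.2, ihc h.1]
  | loop x c ih =>
    exact loop_induction (fun _ B => B a = A a) rfl fun i B hB => (ih h _ B).trans hB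

theorem Cmd.run_add {n : ℕ} (a : RelSym) (x y : Var) (φ : Fm) (e : Var → Fin n) (A : Mem n)
    (b : RelSym) (u v : Fin n) : (add a x y φ).run e A b u v = true ↔
      A b u v = true ∨ (b = a ∧ u = e x ∧ v = e y ∧ φ.Holds A e) := by
  simp only [run]
  split_ifs with h
  · simp only [Mem.insert, h]
    split_ifs with h'
    · simp [h'.1, h'.2.1, h'.2.2]
    · simp only [and_true, or_iff_left h']
  · simp [h]

theorem Cmd.run_add_diag {n : ℕ} (a : RelSym) (x : Var) (φ : Fm) (e : Var → Fin n) (A : Mem n)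
    (b : RelSym) (v : Fin n) : (add a x x φ).run e A b v v = true ↔
      A b v v = true ∨ (b = a ∧ v = e x ∧ φ.Holds A e) := by
  rw [run_add]
  tauto

/-- Propagation along a relation `E`: if the command `c` marks the vertex `y` whenever `x` is marked
and `E x y` holds, then after `n` rounds over all pairs of vertices the set of marked vertices is
closed under `E`. Marks are held on the diagonal of the relation `a`. Any other property that the
command preserves can be put into `I`. -/
theorem Cmd.propagate {n : ℕ} {a : RelSym} {t x y : Var} (hxy : x ≠ y) {c : Cmd}
    {E : Fin n → Fin n → Prop} {I : Mem n → Prop}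
    (hstep : ∀ (e : Var → Fin n) B, I B → I (c.run e B) ∧ ∀ v, c.run e B a v v = true ↔
      B a v v = true ∨ (B a (e x) (e x) = true ∧ E (e x) (e y) ∧ v = e y))
    (e : Var → Fin n) (A : Mem n) (hA : I A) :
    I ((loop t (loop x (loop y c))).run e A) ∧
    (∀ v, A a v v = true → (loop t (loop x (loop y c))).run e A a v v = true) ∧
    ∀ u v, (loop t (loop x (loop y c))).run e A a u u = true → E u v →
      (loop t (loop x (loop y c))).run e A a v v = true := by
  let Closed (B : Mem n) : Prop := ∀ u v, B a u u = true → E u v → B a v v = true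
  have hrow (e : Var → Fin n) (B : Mem n) (hB : I B) :
      I ((loop y c).run e B) ∧ (∀ v, B a v v = true → (loop y c).run e B a v v = true) ∧
      (Closed B → ∀ v, (loop y c).run e B a v v = true → B a v v = true) ∧
      ∀ v, B a (e x) (e x) = true → E (e x) v → (loop y c).run e B a v v = true := by
    have := loop_induction (x := y) (c := c) (e := e) (A := B)
      (fun i B' => I B' ∧ (∀ v, B a v v = true → B' a v v = true) ∧
        (Closed B → ∀ v, B' a v v = true → B a v v = true) ∧
        ∀ v : Fin n, (v : ℕ) < i → B a (e x) (e x) = true → E (e x) v → B' a v v = true)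
      ⟨hB, fun _ => id, fun _ _ => id, fun v hv => absurd hv (Nat.not_lt_zero _)⟩
      (fun i B' ⟨h1, h2, h3, h4⟩ => by
        obtain ⟨h5, h6⟩ := hstep (Function.update e y i) B' h1
        simp only [Function.update_of_ne hxy, Function.update_self] at h6
        refine ⟨h5, fun v hv => (h6 v).2 (.inl (h2 v hv)), fun hc v hv => ?_,
          fun v hv hu hE => ?_⟩
        · rcases (h6 v).1 hv with h | ⟨h, hE, rfl⟩
          · exact h3 hc v h
          · exact hc _ _ (h3 hc _ h) hE
        · rcases Nat.lt_succ_iff_lt_or_eq.1 hv with h | h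
          · exact (h6 v).2 (.inl (h4 v h hu hE))
          · obtain rfl := Fin.ext h
            exact (h6 v).2 (.inr ⟨h2 _ hu, hE, rfl⟩))
    exact ⟨this.1, this.2.1, this.2.2.1, fun v => this.2.2.2 v v.2⟩
  have hpass (e : Var → Fin n) (B : Mem n) (hB : I B) :
      I ((loop x (loop y c)).run e B) ∧
      (∀ v, B a v v = true → (loop x (loop y c)).run e B a v v = true) ∧
      (Closed B → ∀ v, (loop x (loop y c)).run e B a v v = true → B a v v = true) ∧
      ∀ u v, B a u u = true → E u v → (loop x (loop y c)).run e B a v v = true := by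
    have := loop_induction (x := x) (c := loop y c) (e := e) (A := B)
      (fun i B' => I B' ∧ (∀ v, B a v v = true → B' a v v = true) ∧
        (Closed B → ∀ v, B' a v v = true → B a v v = true) ∧
        ∀ u v : Fin n, (u : ℕ) < i → B a u u = true → E u v → B' a v v = true)
      ⟨hB, fun _ => id, fun _ _ => id, fun u v hu => absurd hu (Nat.not_lt_zero _)⟩
      (fun i B' ⟨h1, h2, h3, h4⟩ => by
        obtain ⟨h5, h6, h7, h8⟩ := hrow (Function.update e x i) B' h1
        simp only [Function.update_self] at h8
        refine ⟨h5, fun v hv => h6 v (h2 v hv), fun hc v hv => h3 hc v (h7 ?_ v hv),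
          fun u v hu hBu hE => ?_⟩
        · exact fun p q hp hE => h2 q (hc p q (h3 hc p hp) hE)
        · rcases Nat.lt_succ_iff_lt_or_eq.1 hu with h | h
          · exact h6 v (h4 u v h hBu hE)
          · obtain rfl := Fin.ext h
            exact h8 v (h2 _ hBu) hE)
    exact ⟨this.1, this.2.1, this.2.2.1, fun u v => this.2.2.2 u v u.2⟩
  -- a round that starts with a set that is not closed marks at least one new vertex
  have := loop_induction (x := t) (c := loop x (loop y c)) (e := e) (A := A)
    (fun i B => I B ∧ (∀ v, A a v v = true → B a v v = true) ∧
      (Closed B ∨ i ≤ (Finset.univ.filter fun v => B a v v = true).card))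
    ⟨hA, fun _ => id, .inr (Nat.zero_le _)⟩
    (fun i B ⟨h1, h2, h3⟩ => by
      obtain ⟨h4, h5, h6, h7⟩ := hpass (Function.update e t i) B h1
      refine ⟨h4, fun v hv => h5 v (h2 v hv), ?_⟩
      by_cases hc : Closed B
      · exact .inl fun u v hu hE => h5 v (hc u v (h6 hc u hu) hE)
      · refine .inr ((Nat.succ_le_succ (h3.resolve_left hc)).trans (Finset.card_lt_card ?_))
        simp only [Closed, not_forall] at hc
        obtain ⟨u, v, hu, hE, hv⟩ := hc
        rw [Finset.ssubset_iff_of_subset fun v => by simpa using h5 v]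
        exact ⟨v, by simpa using h7 u v hu hE, by simpa using hv⟩)
  refine ⟨this.1, this.2.1, ?_⟩
  rcases this.2.2 with h | h
  · exact h
  · have huniv := Finset.eq_univ_of_card
      (Finset.univ.filter fun v => (loop t (loop x (loop y c))).run e A a v v = true)
      ((Finset.card_le_univ _).antisymm (by simpa using h))
    intro u v _ _
    simpa using huniv.ge (Finset.mem_univ v)

namespace CubicDecomposition

/-- The adjacency relation. -/
abbrev adj : Var → Var → Fm := .atom 0

/-- Equality of vertices. -/
abbrev eq : Var → Var → Fm := .atom 1

/-- The vertex is known to be reachable from the first vertex. -/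
abbrev reached (x : Var) : Fm := .atom 2 x x

/-- The value of the vertex has been fixed. -/
abbrev fixed (x : Var) : Fm := .atom 3 x x

/-- The value of the vertex: whether it is the center of a claw. -/
abbrev center (x : Var) : Fm := .atom 4 x x

/-- The vertices `x` and `y` are opposite in a diamond. -/
def opposite (x y : Var) : Fm :=
  .and (.not (eq x y)) (.and (.not (adj x y)) (.ex 4 (.ex 5 (.and (adj 4 5)
    (.and (adj x 4) (.and (adj x 5) (.and (adj y 4) (adj y 5))))))))

/-- Exactly one of the vertices `x` and `y` has to be a center. -/
def differ (x y : Var) : Fm :=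
  .or (.and (adj x y) (.not (.ex 4 (.and (adj x 4) (adj y 4))))) (opposite x y)

/-- The vertex `2` cannot be a center. -/
def excluded : Fm :=
  .and (.ex 4 (.ex 5 (.and (adj 4 5) (.and (adj 2 4) (adj 2 5))))) (.not (.ex 3 (opposite 2 3)))

/-- Compute the equality relation. -/
def initEq : Cmd := .loop 0 (.add 1 0 0 .tt)

/-- Mark the first vertex as reached. -/
def initReached : Cmd := .loop 0 (.add 2 0 0 (.not (.ex 1 (reached 1))))

/-- Mark `3` as reached if `2` has been reached and is adjacent to `3`. -/
def stepReached : Cmd := .add 2 3 3 (.and (reached 2) (adj 2 3))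

/-- The vertices that are excluded get the value `false`. -/
def initFixed : Cmd := .loop 2 (.add 3 2 2 excluded)

/-- If the value of `2` has been fixed and the value of `3` has to be different, then fix it. -/
def stepFixed : Cmd :=
  .seq (.add 4 3 3 (.and (fixed 2) (.and (.not (fixed 3)) (.and (differ 2 3) (.not (center 2))))))
    (.add 3 3 3 (.and (fixed 2) (differ 2 3)))

/-- Propagate the values, and then give the next vertex the value `false` if it has none. -/
def roundFixed : Cmd :=
  .seq (.loop 1 (.loop 2 (.loop 3 stepFixed))) (.add 3 0 0 .tt)

/-- The computation of the set of vertices that are reachable from the first vertex, and of a set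
of centers. -/
def command : Cmd :=
  .seq initEq (.seq initReached (.seq (.loop 0 (.loop 2 (.loop 3 stepReached)))
    (.seq initFixed (.loop 0 roundFixed))))

/-- The adjacency relation is that of a connected cubic graph, and the values satisfy the
constraints. -/
def check : Fm :=
  .and (.all 2 (.all 3 (.not (.and (adj 2 3) (.not (adj 3 2)))))) <|
  .and (.all 2 (.not (adj 2 2))) <|
  .and (.all 2 (.ex 3 (.ex 4 (.ex 5 (.and (.not (eq 3 4)) (.and (.not (eq 3 5))
    (.and (.not (eq 4 5)) (.all 6 (.or (.and (adj 2 6) (.or (eq 6 3) (.or (eq 6 4) (eq 6 5))))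
      (.and (.not (adj 2 6)) (.not (.or (eq 6 3) (.or (eq 6 4) (eq 6 5)))))))))))))) <|
  .and (.all 2 (reached 2)) <|
  .and (.all 2 (.all 3 (.not (.and (differ 2 3) (.or (.and (center 2) (center 3))
    (.and (.not (center 2)) (.not (center 3)))))))) <|
  .all 2 (.not (.and excluded (center 2)))

theorem command_fresh : command.Fresh ∅ := by
  simp [command, initEq, initReached, stepReached, initFixed, roundFixed, stepFixed, excluded,
    differ, opposite, Fm.or, Cmd.Fresh, Fm.Fresh]

theorem check_fresh : check.Fresh ∅ := by
  simp [check, excluded, differ, opposite, Fm.or, Fm.all, Fm.Fresh]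

variable {n : ℕ} {G : SimpleGraph (Fin n)} {A : Mem n}

/-- The relations `0` and `1` are the adjacency relation of `G` and equality. -/
structure Represents (A : Mem n) (G : SimpleGraph (Fin n)) : Prop where
  adj : ∀ u v, A 0 u v = true ↔ G.Adj u v
  eq : ∀ u v, A 1 u v = true ↔ u = v

theorem Represents.run (hA : Represents A G) {c : Cmd} (h0 : 0 ∉ c.writes) (h1 : 1 ∉ c.writes)
    (e : Var → Fin n) : Represents (c.run e A) G := by
  refine ⟨?_, ?_⟩
  · simpa only [Cmd.run_of_notMem_writes h0] using hA.adj
  · simpa only [Cmd.run_of_notMem_writes h1] using hA.eq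

theorem Represents.holds_opposite (hA : Represents A G) {x y : Var} (hx : x < 4) (hy : y < 4)
    (e : Var → Fin n) : (opposite x y).Holds A e ↔ G.Opposite (e x) (e y) := by
  have h1 : x ≠ 4 := hx.ne
  have h2 : x ≠ 5 := (hx.trans (by decide)).ne
  have h3 : y ≠ 4 := hy.ne
  have h4 : y ≠ 5 := (hy.trans (by decide)).ne
  simp [opposite, Fm.Holds, hA.adj, hA.eq, SimpleGraph.Opposite, h1, h2, h3, h4]

theorem Represents.holds_differ (hA : Represents A G) (e : Var → Fin n) :
    (differ 2 3).Holds A e ↔ G.Differ (e 2) (e 3) := by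
  rw [differ, Fm.holds_or, hA.holds_opposite (by decide) (by decide)]
  simp [Fm.Holds, hA.adj, SimpleGraph.Differ]

theorem Represents.holds_excluded (hA : Represents A G) (e : Var → Fin n) :
    excluded.Holds A e ↔ G.Excluded (e 2) := by
  simp [excluded, Fm.Holds, hA.adj, SimpleGraph.Excluded,
    hA.holds_opposite (show (2 : Var) < 4 by decide) (show (3 : Var) < 4 by decide)]

/-! ### Correctness of the decision procedure -/

theorem run_initEq (e : Var → Fin n) (h : ∀ u v, A 1 u v = false) (u v : Fin n) :
    initEq.run e A 1 u v = true ↔ u = v := by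
  have := Cmd.loop_induction (x := 0) (c := .add 1 0 0 .tt) (e := e) (A := A)
    (fun i B => ∀ u v : Fin n, B 1 u v = true ↔ u = v ∧ (u : ℕ) < i) (by simp [h])
    (fun i B hB u v => by
      rw [Cmd.run_add, hB]
      simp only [Function.update_self, Fm.Holds, true_and, and_true]
      constructor
      · rintro (h | ⟨rfl, rfl⟩)
        · exact ⟨h.1, h.2.trans (Nat.lt_succ_self _)⟩
        · exact ⟨rfl, Nat.lt_succ_self _⟩
      · rintro ⟨rfl, hu⟩
        rcases Nat.lt_succ_iff_lt_or_eq.1 hu with hu | hu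
        · exact .inl ⟨rfl, hu⟩
        · exact .inr ⟨Fin.ext hu, Fin.ext hu⟩)
  unfold initEq
  simpa using this u v

theorem run_initReached (hn : 0 < n) (e : Var → Fin n) (h : ∀ v, A 2 v v = false) (v : Fin n) :
    initReached.run e A 2 v v = true ↔ v = ⟨0, hn⟩ := by
  have := Cmd.loop_induction (x := 0) (c := .add 2 0 0 (.not (.ex 1 (reached 1)))) (e := e) (A := A)
    (fun i B => ∀ v : Fin n, B 2 v v = true ↔ v = ⟨0, hn⟩ ∧ 0 < i) (by simp [h])
    (fun i B hB v => by
      rw [Cmd.run_add_diag, hB]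
      simp only [Fm.Holds, Function.update_self, hB, true_and]
      rcases Nat.eq_zero_or_pos i with hi | hi
      · have : i = ⟨0, hn⟩ := Fin.ext hi
        simp [this]
      · simp [hi])
  unfold initReached
  simpa [hn] using this v

theorem run_initFixed (hA : Represents A G) (e : Var → Fin n) (h : ∀ v, A 3 v v = false)
    (v : Fin n) : initFixed.run e A 3 v v = true ↔ G.Excluded v := by
  have := Cmd.loop_induction (x := 2) (c := .add 3 2 2 excluded) (e := e) (A := A)
    (fun i B => Represents B G ∧ ∀ v : Fin n, B 3 v v = true ↔ G.Excluded v ∧ (v : ℕ) < i)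
    (by simp [h, hA])
    (fun i B ⟨hB, hB'⟩ => by
      refine ⟨hB.run (by decide) (by decide) _, fun v => ?_⟩
      rw [Cmd.run_add_diag, hB', hB.holds_excluded]
      simp only [Function.update_self, true_and]
      constructor
      · rintro (h | ⟨rfl, h⟩)
        · exact ⟨h.1, h.2.trans (Nat.lt_succ_self _)⟩
        · exact ⟨h, Nat.lt_succ_self _⟩
      · rintro ⟨h, hv⟩
        rcases Nat.lt_succ_iff_lt_or_eq.1 hv with hv | hv
        · exact .inl ⟨h, hv⟩
        · obtain rfl := Fin.ext hv
          exact .inr ⟨rfl, h⟩)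
  unfold initFixed
  simpa using this.2 v

/-- Propagation along the edges marks the component of `r`. -/
theorem run_stepReached (hA : Represents A G) (e : Var → Fin n) {r : Fin n}
    (h : ∀ v, A 2 v v = true ↔ v = r) (v : Fin n) :
    (Cmd.loop 0 (.loop 2 (.loop 3 stepReached))).run e A 2 v v = true ↔ G.Reachable r v := by
  obtain ⟨⟨_, h1⟩, h2, h3⟩ := Cmd.propagate (a := 2) (t := 0) (x := 2) (y := 3) (by decide)
    (c := stepReached) (E := G.Adj)
    (I := fun B => Represents B G ∧ ∀ v, B 2 v v = true → G.Reachable r v)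
    (fun e B ⟨hB, hB'⟩ => by
      have key (v : Fin n) : stepReached.run e B 2 v v = true ↔
          B 2 v v = true ∨ (B 2 (e 2) (e 2) = true ∧ G.Adj (e 2) (e 3) ∧ v = e 3) := by
        rw [stepReached, Cmd.run_add_diag]
        simp only [Fm.Holds, hB.adj]
        tauto
      refine ⟨⟨hB.run (by decide) (by decide) _, fun v hv => ?_⟩, key⟩
      rcases (key v).1 hv with h | ⟨h, hadj, rfl⟩
      · exact hB' v h
      · exact (hB' _ h).trans hadj.reachable)
    e A ⟨hA, fun v hv => by rw [(h v).1 hv]⟩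
  refine ⟨h1 v, fun ⟨p⟩ => ?_⟩
  have (u w : Fin n) (p : G.Walk u w) :
      (Cmd.loop 0 (.loop 2 (.loop 3 stepReached))).run e A 2 u u = true →
      (Cmd.loop 0 (.loop 2 (.loop 3 stepReached))).run e A 2 w w = true := by
    induction p with
    | nil => exact id
    | cons hadj _ ih => exact fun hu => ih (h3 _ _ hu hadj)
  exact this _ _ p (h2 r ((h r).2 rfl))

/-- The partial assignment in `A` extends to a solution: the fixed vertices, which the relation `3`
marks, have the values of some solution in the relation `4`, and all other vertices have the value
`false`. The excluded vertices are among the fixed ones. -/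
structure Extends (A : Mem n) (G : SimpleGraph (Fin n)) : Prop extends Represents A G where
  fixed_of_excluded : ∀ u, G.Excluded u → A 3 u u = true
  exists_isSolution : ∃ x, G.IsSolution x ∧
    ∀ u, (A 3 u u = true → (A 4 u u = true ↔ x u)) ∧ (A 3 u u ≠ true → A 4 u u ≠ true)

theorem Extends.run_stepFixed (hA : Extends A G) (e : Var → Fin n) :
    Extends (stepFixed.run e A) G ∧ ∀ v, stepFixed.run e A 3 v v = true ↔
      A 3 v v = true ∨ (A 3 (e 2) (e 2) = true ∧ G.Differ (e 2) (e 3) ∧ v = e 3) := by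
  have hR := hA.toRepresents
  have hR' := hR.run (c := .add 4 3 3 (.and (fixed 2) (.and (.not (fixed 3))
    (.and (differ 2 3) (.not (center 2)))))) (by decide) (by decide) e
  have key3 (v : Fin n) : stepFixed.run e A 3 v v = true ↔
      A 3 v v = true ∨ (A 3 (e 2) (e 2) = true ∧ G.Differ (e 2) (e 3) ∧ v = e 3) := by
    rw [stepFixed, Cmd.run, Cmd.run_add_diag, Fm.Holds, hR'.holds_differ]
    simp only [Fm.Holds, Cmd.run_add_diag, show (3 : RelSym) ≠ 4 by decide, false_and, or_false,
      true_and]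
    tauto
  have key4 (v : Fin n) : stepFixed.run e A 4 v v = true ↔ A 4 v v = true ∨
      (v = e 3 ∧ A 3 (e 2) (e 2) = true ∧ A 3 (e 3) (e 3) ≠ true ∧ G.Differ (e 2) (e 3) ∧
        A 4 (e 2) (e 2) ≠ true) := by
    rw [stepFixed, Cmd.run, Cmd.run_add_diag, Cmd.run_add_diag]
    simp only [Fm.Holds, hR.holds_differ, show (4 : RelSym) ≠ 3 by decide, false_and, or_false,
      true_and, ne_eq]
  refine ⟨⟨hR.run (by decide) (by decide) e, fun u hu => (key3 u).2 (.inl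
    (hA.fixed_of_excluded u hu)), ?_⟩, key3⟩
  obtain ⟨x, hx, h⟩ := hA.exists_isSolution
  refine ⟨x, hx, fun u => ?_⟩
  rw [ne_eq, ne_eq, key3, key4]
  by_cases hu : A 3 u u = true
  · have : ¬ (u = e 3 ∧ A 3 (e 2) (e 2) = true ∧ A 3 (e 3) (e 3) ≠ true ∧ G.Differ (e 2) (e 3) ∧
        A 4 (e 2) (e 2) ≠ true) := by
      rintro ⟨rfl, -, h, -⟩
      exact h hu
    simp only [this, or_false, hu, true_or, not_true_eq_false, false_implies, and_true,
      true_implies]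
    exact (h u).1 hu
  · have h4 := (h u).2 hu
    by_cases h' : A 3 (e 2) (e 2) = true ∧ G.Differ (e 2) (e 3) ∧ u = e 3
    · obtain ⟨h2, hd, rfl⟩ := h'
      have h5 := (h _).1 h2
      have h6 := hx.differ _ _ hd
      simp only [hu, h2, hd]
      tauto
    · tauto

/-- A round does not lose the extensibility. After the propagation, the fixed vertices are a union
of components of the relation `Differ`, so that the next vertex may be given either value. -/
theorem Extends.run_roundFixed (hA : Extends A G) (e : Var → Fin n) :
    Extends (roundFixed.run e A) G ∧ roundFixed.run e A 3 (e 0) (e 0) = true ∧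
      ∀ v, A 3 v v = true → roundFixed.run e A 3 v v = true := by
  obtain ⟨h1, h2, h3⟩ := Cmd.propagate (a := 3) (t := 1) (x := 2) (y := 3) (by decide)
    (c := stepFixed) (E := G.Differ) (I := fun B => Extends B G)
    (fun e B hB => hB.run_stepFixed e) e A hA
  generalize hB : (Cmd.loop 1 (.loop 2 (.loop 3 stepFixed))).run e A = B at h1 h2 h3
  have key3 (v : Fin n) : roundFixed.run e A 3 v v = true ↔ B 3 v v = true ∨ v = e 0 := by
    rw [roundFixed, Cmd.run, hB, Cmd.run_add_diag]
    simp [Fm.Holds]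
  have key4 : roundFixed.run e A 4 = B 4 := by
    rw [roundFixed, Cmd.run, hB, Cmd.run_of_notMem_writes (by decide)]
  refine ⟨⟨hA.toRepresents.run (by decide) (by decide) e,
    fun u hu => (key3 u).2 (.inl (h1.fixed_of_excluded u hu)), ?_⟩, (key3 _).2 (.inr rfl),
    fun v hv => (key3 v).2 (.inl (h2 v hv))⟩
  obtain ⟨x, hx, h⟩ := h1.exists_isSolution
  simp only [key4, ne_eq, key3]
  by_cases hr : B 3 (e 0) (e 0) ≠ true ∧ x (e 0)
  · -- no constraint relates the fixed values to the others, so these can be complemented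
    refine ⟨fun u => if B 3 u u = true then x u else ¬ x u, ⟨fun u v hd => ?_, fun u hu => ?_⟩,
      fun u => ?_⟩
    · have h4 := hx.differ _ _ hd
      have h5 : B 3 u u = true ↔ B 3 v v = true := ⟨fun h => h3 u v h hd, fun h => h3 v u h hd.symm⟩
      simp only [h5]
      split_ifs <;> tauto
    · simpa [h1.fixed_of_excluded u hu] using hx.excluded u hu
    · have := h u
      dsimp only
      split_ifs with h4
      · tauto
      · refine ⟨?_, by tauto⟩
        rintro (h5 | rfl)
        · exact absurd h5 h4
        · tauto
  · refine ⟨x, hx, fun u => ?_⟩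
    have := h u
    refine ⟨?_, by tauto⟩
    rintro (h5 | rfl)
    · tauto
    · tauto

theorem Extends.isSolution_run (hA : Extends A G) (e : Var → Fin n) :
    G.IsSolution fun v => (Cmd.loop 0 roundFixed).run e A 4 v v = true := by
  obtain ⟨h, h'⟩ := Cmd.loop_induction (x := 0) (c := roundFixed) (e := e) (A := A)
    (fun i B => Extends B G ∧ ∀ v : Fin n, (v : ℕ) < i → B 3 v v = true)
    ⟨hA, fun v hv => absurd hv (Nat.not_lt_zero _)⟩
    (fun i B ⟨hB, hB'⟩ => by
      obtain ⟨h1, h2, h3⟩ := hB.run_roundFixed (Function.update e 0 i)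
      refine ⟨h1, fun v hv => ?_⟩
      rcases Nat.lt_succ_iff_lt_or_eq.1 hv with hv | hv
      · exact h3 v (hB' v hv)
      · obtain rfl := Fin.ext hv
        simpa using h2)
  obtain ⟨x, hx, hx'⟩ := h.exists_isSolution
  have : (fun v => (Cmd.loop 0 roundFixed).run e A 4 v v = true) = x :=
    funext fun v => propext ((hx' v).1 (h' v v.2))
  rwa [this]

theorem run_command_zero (e : Var → Fin n) (R : Fin n → Fin n → Bool) :
    command.run e (Mem.initial R) 0 = R :=
  Cmd.run_of_notMem_writes (by decide) e _

theorem run_command_one (e : Var → Fin n) (R : Fin n → Fin n → Bool) (u v : Fin n) :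
    command.run e (Mem.initial R) 1 u v = true ↔ u = v := by
  rw [command, Cmd.run, Cmd.run_of_notMem_writes (by decide)]
  exact run_initEq e (fun _ _ => rfl) u v

theorem represents_initEq (e : Var → Fin n) {R : Fin n → Fin n → Bool}
    (hR : ∀ u v, R u v = true ↔ G.Adj u v) : Represents (initEq.run e (Mem.initial R)) G := by
  refine ⟨fun u v => ?_, run_initEq e fun _ _ => rfl⟩
  rw [Cmd.run_of_notMem_writes (by decide)]
  exact hR u v

theorem run_command_reached (hn : 0 < n) (e : Var → Fin n) {R : Fin n → Fin n → Bool}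
    (hR : ∀ u v, R u v = true ↔ G.Adj u v) (v : Fin n) :
    command.run e (Mem.initial R) 2 v v = true ↔ G.Reachable ⟨0, hn⟩ v := by
  simp only [command, Cmd.run.eq_2]
  rw [Cmd.run_of_notMem_writes (by decide), Cmd.run_of_notMem_writes (by decide)]
  refine run_stepReached ((represents_initEq e hR).run (by decide) (by decide) e) e
    (run_initReached hn e fun v => ?_) v
  rw [Cmd.run_of_notMem_writes (by decide)]
  rfl

/-- If the constraints can be satisfied at all, then the computed set of centers satisfies them. -/
theorem isSolution_run_command (e : Var → Fin n) {R : Fin n → Fin n → Bool}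
    (hR : ∀ u v, R u v = true ↔ G.Adj u v) (h : ∃ x, G.IsSolution x) :
    G.IsSolution fun v => command.run e (Mem.initial R) 4 v v = true := by
  simp only [command, Cmd.run.eq_2]
  apply Extends.isSolution_run
  have h1 := ((represents_initEq e hR).run (c := initReached) (by decide) (by decide) e).run
    (c := .loop 0 (.loop 2 (.loop 3 stepReached))) (by decide) (by decide) e
  have h3 := run_initFixed h1 e fun v => by
    rw [Cmd.run_of_notMem_writes (by decide), Cmd.run_of_notMem_writes (by decide),
      Cmd.run_of_notMem_writes (by decide)]
    rfl
  refine ⟨h1.run (by decide) (by decide) e, fun u hu => (h3 u).2 hu, ?_⟩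
  obtain ⟨x, hx⟩ := h
  refine ⟨x, hx, fun u => ?_⟩
  rw [Cmd.run_of_notMem_writes (a := 4) (by decide), Cmd.run_of_notMem_writes (a := 4) (by decide),
    Cmd.run_of_notMem_writes (a := 4) (by decide), Cmd.run_of_notMem_writes (a := 4) (by decide),
    h3]
  simpa [Mem.initial] using hx.excluded u

theorem Represents.holds_check (hA : Represents A G) (e : Var → Fin n) :
    check.Holds A e ↔ G.HasThreeNeighbors ∧ (∀ v, A 2 v v = true) ∧
      G.IsSolution fun v => A 4 v v = true := by
  have h1 : (∀ u v, (G.Differ u v → (A 4 u u = true ↔ ¬ A 4 v v = true))) ∧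
      (∀ u, G.Excluded u → ¬ A 4 u u = true) ↔ G.IsSolution fun v => A 4 v v = true :=
    ⟨fun h => ⟨h.1, h.2⟩, fun h => ⟨h.1, h.2⟩⟩
  have h2 : (∀ v, ∃ a b c, ¬ a = b ∧ ¬ a = c ∧ ¬ b = c ∧ ∀ w,
      (G.Adj v w ∧ (w = a ∨ w = b ∨ w = c)) ∨
      (¬ G.Adj v w ∧ ¬ (w = a ∨ w = b ∨ w = c))) ↔ G.HasThreeNeighbors := by
    simp only [← iff_iff_and_or_not_and_not]
    rfl
  have h3 : (∀ u v, ¬ (G.Differ u v ∧ ((A 4 u u = true ∧ A 4 v v = true) ∨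
      (¬ A 4 u u = true ∧ ¬ A 4 v v = true)))) ↔
      ∀ u v, G.Differ u v → (A 4 u u = true ↔ ¬ A 4 v v = true) :=
    forall₂_congr fun u v => by tauto
  rw [← h1, ← h2, ← h3]
  simp only [check, Fm.Holds, Fm.holds_all, Fm.holds_or, hA.holds_differ, hA.holds_excluded, hA.adj,
    hA.eq]
  simpa using fun _ _ _ _ _ _ (h : G.Adj _ _) => h.symm

/-- The formula `check` ensures that the relation `0` is the adjacency relation of a graph. -/
theorem exists_represents (e : Var → Fin n) (h : check.Holds A e)
    (hA : ∀ u v, A 1 u v = true ↔ u = v) : ∃ G, Represents A G := by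
  simp only [check, Fm.Holds, Fm.holds_all] at h
  have hs := h.1
  have hi := h.2.1
  simp at hs hi
  exact ⟨⟨fun u v => A 0 u v = true, ⟨hs⟩, ⟨fun u => by simp [hi u]⟩⟩, ⟨fun u v => Iff.rfl, hA⟩⟩

end CubicDecomposition

theorem SimpleGraph.hasThreeNeighbors_iff_isCubic {n : ℕ} {G : SimpleGraph (Fin n)} :
    G.HasThreeNeighbors ↔ IsCubic G := by
  classical
  refine forall_congr' fun v => ?_
  rw [← SimpleGraph.card_neighborFinset_eq_degree, Finset.card_eq_three]
  simp [Finset.ext_iff, ← and_assoc]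

/-- The computation is correct for the graphs with a decomposition, and the final check rejects
everything else, including matrices that do not encode a graph. -/
theorem cubicDecompositionProblem_eq_language :
    cubicDecompositionProblem {clawGraph, triangleGraph} =
      CubicDecomposition.command.language CubicDecomposition.check := by
  classical
  ext w
  constructor
  · rintro ⟨n, G, rfl, hc, hG, hd⟩
    rw [← SimpleGraph.hasThreeNeighbors_iff_isCubic] at hG
    obtain ⟨v⟩ := hc.nonempty
    have hn : 0 < n := v.pos
    have hR : ∀ u v, decide (G.Adj u v) = true ↔ G.Adj u v := fun u v => decide_eq_true_iff
    refine ⟨n, hn, fun u v => decide (G.Adj u v), ?_, ?_⟩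
    · simp only [encodeGraph, adjacencyBits, matrixBits]
    · rw [CubicDecomposition.Represents.holds_check (G := G) ⟨fun u v => ?_, fun u v => ?_⟩]
      · refine ⟨hG, fun v => ?_, ?_⟩
        · rw [CubicDecomposition.run_command_reached hn _ hR]
          exact hc.preconnected _ _
        · exact CubicDecomposition.isSolution_run_command _ hR
            ((SimpleGraph.isDecomposable_iff hG hc.preconnected).1 hd)
      · rw [CubicDecomposition.run_command_zero, hR]
      · exact CubicDecomposition.run_command_one _ _ u v
  · rintro ⟨n, hn, R, rfl, h⟩
    obtain ⟨G, hA⟩ := CubicDecomposition.exists_represents _ h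
      (CubicDecomposition.run_command_one _ _)
    have hR : ∀ u v, R u v = true ↔ G.Adj u v := by
      simpa only [CubicDecomposition.run_command_zero] using hA.adj
    obtain ⟨hG, hr, hx⟩ := (hA.holds_check _).1 h
    simp only [CubicDecomposition.run_command_reached hn _ hR] at hr
    have hc : G.Preconnected := fun u v => (hr u).symm.trans (hr v)
    have : Nonempty (Fin n) := ⟨⟨0, hn⟩⟩
    refine ⟨n, G, ?_, ⟨hc⟩, SimpleGraph.hasThreeNeighbors_iff_isCubic.1 hG,
      (SimpleGraph.isDecomposable_iff hG hc).2 ⟨_, hx⟩⟩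
    have : R = fun u v => decide (G.Adj u v) := by
      funext u v
      rw [Bool.eq_iff_iff, hR, decide_eq_true_iff]
    rw [this]
    simp only [encodeGraph, adjacencyBits, matrixBits]

theorem mainTheorem6 : InP (cubicDecompositionProblem {clawGraph, triangleGraph}) := by
  rw [cubicDecompositionProblem_eq_language]
  exact Cmd.inP_language CubicDecomposition.command_fresh CubicDecomposition.check_fresh
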